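/- Let $m,n$ be finite positive Borel measures on $[-1,1]$ that have no atom at $\pm1$, and suppose that there is a constant $C$ with $m+n\le Cm$ and $m+n\le Cn$. For continuous $\varphi=(\varphi_1,\varphi_2):[-1,1]\to\mathbf C^2$ put $M\varphi=(\varphi_2\,n,\ \varphi_1\,m)$. A number $\lambda\in\mathbf C$ is a (Dirichlet) eigenvalue if there is a nonzero continuous $\varphi$ with $\varphi(\pm1)=0$ and $D^2\varphi=\lambda M\varphi$ in the sense of distributions on $(-1,1)$; then $f=D\varphi$ is an eigenfunction for $\lambda$. For every eigenvalue $\lambda_\nu$ (each listed once) choose one eigenfunction $f_\nu$. Let $\mathcal H=L^2([-1,1];\mathbf C^2)$ and $\langle f,g\rangle=\int_{-1}^1(f_1\overline{g_2}+f_2\overline{g_1})\,dx$. Let $D_0^{-1}$ be the linear operator that is $0$ on constant functions and $D_0^{-1}g(x)=\frac12\int_{-1}^xg-\frac12\int_x^1g$ on functions $g\in\mathcal H$ with $\int_{-1}^1g=0$; for a measure $\mu$ let $D_1^{-1}\mu(x)=\frac12\int_{-1}^x(y+1)\,d\mu(y)+\frac12\int_x^1(y-1)\,d\mu(y)$; and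 let $T=D_1^{-1}MD_0^{-1}$, a bounded operator on $\mathcal H$. Then for each $\lambda\in\mathbf C$ that is not an eigenvalue: $\langle f_\nu,f_\nu\rangle\neq0$ for all $\nu$; $I-\lambda T$ is invertible; the operator $R_\lambda=I-(I-\lambda T)^{-1}$ has an integral kernel $\widehat K_\lambda\in L^2([-1,1]^2;M(2,\mathbf C))$; and $$\sum_\nu\frac{\lambda}{\lambda-\lambda_\nu}\,\frac1{\langle f_\nu,f_\nu\rangle}\begin{bmatrix} f_{\nu,1}(x)\overline{f_{\nu,2}(y)}& f_{\nu,1}(x)\overline{f_{\nu,1}(y)}\\ f_{\nu,2}(x)\overline{f_{\nu,2}(y)}&f_{\nu,2}(x)\overline{f_{\nu,1}(y)}\end{bmatrix}$$ converges (unconditionally) in the norm of $L^2([-1,1]^2;M(2,\mathbf C))$ to $\widehat K_\lambda(x,y)$. (If the $f_\nu$ are chosen real, the bars may be dropped.) -/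

import Mathlib

open MeasureTheory Set Filter Topology
open scoped ENNReal NNReal ContDiff ComplexConjugate

noncomputable section

attribute [local instance] Matrix.frobeniusNormedAddCommGroup

namespace Beam

/-- Lebesgue measure on the interval `[-1, 1]`. -/
abbrev leb : Measure ℝ := volume.restrict (Icc (-1) 1)

/-- `ℂ²` with its Hermitian norm; the components `1, 2` are the coordinates `0, 1`. -/
abbrev Vec : Type := EuclideanSpace ℂ (Fin 2)

/-- The Hilbert space `L²([-1, 1]; ℂ²)`. -/
abbrev Hil : Type := Lp Vec 2 leb

/-- Real test functions with compact support in the open interval `(-1, 1)`. -/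
structure IsTest (η : ℝ → ℝ) : Prop where
  smooth : ContDiff ℝ ∞ η
  compact : HasCompactSupport η
  supp : tsupport η ⊆ Ioo (-1) 1

/-- `φ` is a continuous solution on `[-1, 1]` of `D² φ = l M φ`, that is, of
`D² φ₁ = l φ₂ n`, `D² φ₂ = l φ₁ m` in the sense of distributions on `(-1, 1)`,
with the Dirichlet conditions `φ(-1) = φ(1) = 0`. -/
structure IsDirichletSolution (m n : Measure ℝ) (l : ℂ) (φ : ℝ → Vec) : Prop where
  cont : ContinuousOn φ (Icc (-1) 1)
  left : φ (-1) = 0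
  right : φ 1 = 0
  eq₁ : ∀ η : ℝ → ℝ, IsTest η →
    ∫ x, φ x 0 * ((iteratedDeriv 2 η x : ℝ) : ℂ) ∂leb = l * ∫ x, φ x 1 * ((η x : ℝ) : ℂ) ∂n
  eq₂ : ∀ η : ℝ → ℝ, IsTest η →
    ∫ x, φ x 1 * ((iteratedDeriv 2 η x : ℝ) : ℂ) ∂leb = l * ∫ x, φ x 0 * ((η x : ℝ) : ℂ) ∂m

/-- The set of Dirichlet eigenvalues: the `l ∈ ℂ` for which there is a solution that does not
vanish identically on `[-1, 1]`. -/
def eigenvalues (m n : Measure ℝ) : Set ℂ :=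
  {l | ∃ φ : ℝ → Vec, IsDirichletSolution m n l φ ∧ ∃ x ∈ Icc (-1 : ℝ) 1, φ x ≠ 0}

/-- `f = D φ` in the sense of distributions on `(-1, 1)`. -/
def IsDistribDeriv (φ : ℝ → Vec) (f : Hil) : Prop :=
  ∀ η : ℝ → ℝ, IsTest η → ∫ x, deriv η x • φ x ∂leb = -∫ x, η x • f x ∂leb

/-- `f` is the derivative `D φ` of a nonzero solution `φ` of the Dirichlet problem with
eigenvalue `l`. -/
def IsEigenfunction (m n : Measure ℝ) (l : ℂ) (f : Hil) : Prop :=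
  ∃ φ : ℝ → Vec, IsDirichletSolution m n l φ ∧ (∃ x ∈ Icc (-1 : ℝ) 1, φ x ≠ 0) ∧
    IsDistribDeriv φ f

/-- The mean value of `g` over `[-1, 1]`: the component of `g` in the space of constants. -/
def mean (g : Hil) : Vec := (1 / 2 : ℝ) • ∫ y, g y ∂leb

/-- The operator `D₀⁻¹`: it vanishes on the constants, and on functions `h` with integral zero it
is `½ ∫_{-1}^x h - ½ ∫_x^1 h`; so on a general `g` it is this expression for `h = g - mean g`. -/
def D0inv (g : Hil) (x : ℝ) : Vec :=
  (1 / 2 : ℝ) • ∫ y in Ico (-1) x, (g y - mean g) ∂leb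
    - (1 / 2 : ℝ) • ∫ y in Icc x 1, (g y - mean g) ∂leb

/-- The operator `D₁⁻¹` applied to the measure `ψ r`:
`½ ∫_{-1}^x (y + 1) ψ(y) dr(y) + ½ ∫_x^1 (y - 1) ψ(y) dr(y)`. -/
def D1inv (r : Measure ℝ) (ψ : ℝ → ℂ) (x : ℝ) : ℂ :=
  (1 / 2 : ℝ) • ∫ y in Ico (-1) x, (y + 1) • ψ y ∂r
    + (1 / 2 : ℝ) • ∫ y in Icc x 1, (y - 1) • ψ y ∂r

/-- The function `D₁⁻¹ M D₀⁻¹ f`, with `M φ = (φ₂ n, φ₁ m)`. -/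
def Tfun (m n : Measure ℝ) (f : Hil) (x : ℝ) : Vec :=
  !₂[D1inv n (fun y => D0inv f y 1) x, D1inv m (fun y => D0inv f y 0) x]

lemma stronglyMeasurable_setIntegral {F : Type*} [NormedAddCommGroup F] [NormedSpace ℝ F]
    (r : Measure ℝ) [SFinite r] (S : ℝ → Set ℝ) (hS : MeasurableSet {p : ℝ × ℝ | p.2 ∈ S p.1})
    (h : ℝ → F) (hh : AEStronglyMeasurable h r) :
    StronglyMeasurable (fun x => ∫ y in S x, h y ∂r) := by
  have hSx : ∀ x, MeasurableSet (S x) := fun x => measurable_prodMk_left hS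
  have : (fun x => ∫ y in S x, h y ∂r)
      = fun x => ∫ y, ({p : ℝ × ℝ | p.2 ∈ S p.1}.indicator (fun p => hh.mk h p.2)) (x, y) ∂r := by
    funext x
    rw [setIntegral_congr_ae (g := hh.mk h) (hSx x)
      (hh.ae_eq_mk.mono fun y hy _ => hy), ← integral_indicator (hSx x)]
    rfl
  rw [this]
  exact ((hh.stronglyMeasurable_mk.comp_measurable measurable_snd).indicator hS).integral_prod_right'

lemma measurableSet_left : MeasurableSet {p : ℝ × ℝ | p.2 ∈ Ico (-1) p.1} :=
  (measurableSet_le measurable_const measurable_snd).inter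
    (measurableSet_lt measurable_snd measurable_fst)

lemma measurableSet_right : MeasurableSet {p : ℝ × ℝ | p.2 ∈ Icc p.1 1} :=
  (measurableSet_le measurable_fst measurable_snd).inter
    (measurableSet_le measurable_snd measurable_const)

lemma integrable_coe (g : Hil) : Integrable g leb :=
  (Lp.memLp g).integrable (by norm_num)

lemma integrable_sub_mean (g : Hil) : Integrable (fun y => g y - mean g) leb :=
  (integrable_coe g).sub (integrable_const _)

lemma mean_add (f g : Hil) : mean (f + g) = mean f + mean g := by
  unfold mean
  rw [integral_congr_ae (Lp.coeFn_add f g), ← smul_add,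
    ← integral_add (integrable_coe f) (integrable_coe g)]
  rfl

lemma mean_smul (c : ℂ) (f : Hil) : mean (c • f) = c • mean f := by
  unfold mean
  rw [integral_congr_ae (Lp.coeFn_smul c f), smul_comm c, ← integral_smul c]
  rfl

lemma D0inv_add (f g : Hil) (x : ℝ) : D0inv (f + g) x = D0inv f x + D0inv g x := by
  have key : (fun y => (f + g : Hil) y - mean (f + g))
      =ᵐ[leb] fun y => (f y - mean f) + (g y - mean g) := by
    filter_upwards [Lp.coeFn_add f g] with y hy
    rw [hy, mean_add, Pi.add_apply]
    abel
  unfold D0inv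
  rw [integral_congr_ae (ae_restrict_of_ae key), integral_congr_ae (ae_restrict_of_ae key),
    integral_add (integrable_sub_mean f).integrableOn (integrable_sub_mean g).integrableOn,
    integral_add (integrable_sub_mean f).integrableOn (integrable_sub_mean g).integrableOn,
    smul_add, smul_add]
  abel

lemma D0inv_smul (c : ℂ) (f : Hil) (x : ℝ) : D0inv (c • f) x = c • D0inv f x := by
  have key : (fun y => (c • f : Hil) y - mean (c • f)) =ᵐ[leb] fun y => c • (f y - mean f) := by
    filter_upwards [Lp.coeFn_smul c f] with y hy
    rw [hy, mean_smul, Pi.smul_apply, smul_sub]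
  unfold D0inv
  rw [integral_congr_ae (ae_restrict_of_ae key), integral_congr_ae (ae_restrict_of_ae key),
    integral_smul, integral_smul, smul_sub, smul_comm c, smul_comm c]

lemma stronglyMeasurable_D0inv (g : Hil) : StronglyMeasurable (D0inv g) := by
  have h := (integrable_sub_mean g).aestronglyMeasurable
  exact ((stronglyMeasurable_setIntegral leb (fun x => Ico (-1) x) measurableSet_left _ h).const_smul (1 / 2 : ℝ)).sub
    ((stronglyMeasurable_setIntegral leb (fun x => Icc x 1) measurableSet_right _ h).const_smul (1 / 2 : ℝ))

lemma integral_norm_le (g : Hil) : ∫ y, ‖g y‖ ∂leb ≤ 2 * ‖g‖ := by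
  have h1 : ∫ y, ‖g y‖ ∂leb = (eLpNorm g 1 leb).toReal := by
    rw [eLpNorm_one_eq_lintegral_enorm,
      integral_norm_eq_lintegral_enorm (Lp.aestronglyMeasurable g)]
  have h2 := eLpNorm_le_eLpNorm_mul_rpow_measure_univ (μ := leb) (p := 1) (q := 2) (f := g)
    (by norm_num) (Lp.aestronglyMeasurable g)
  have hu : leb univ = 2 := by
    simp [leb]; norm_num
  have h3 : (leb univ) ^ (1 / (1 : ℝ≥0∞).toReal - 1 / (2 : ℝ≥0∞).toReal) ≤ 2 := by
    rw [hu]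
    calc (2 : ℝ≥0∞) ^ (1 / (1 : ℝ≥0∞).toReal - 1 / (2 : ℝ≥0∞).toReal) ≤ 2 ^ (1 : ℝ) :=
          ENNReal.rpow_le_rpow_of_exponent_le (by norm_num) (by norm_num)
      _ = 2 := by simp
  rw [h1, Lp.norm_def, mul_comm]
  have h4 : eLpNorm g 1 leb ≤ eLpNorm g 2 leb * 2 := h2.trans (mul_le_mul_right h3 _)
  have := ENNReal.toReal_mono (ENNReal.mul_ne_top (Lp.eLpNorm_ne_top g) (by norm_num)) h4
  simpa using this

lemma norm_D0inv_le (g : Hil) (x : ℝ) : ‖D0inv g x‖ ≤ 4 * ‖g‖ := by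
  have hm : ‖mean g‖ ≤ ‖g‖ := by
    unfold mean
    rw [norm_smul]
    have := (norm_integral_le_integral_norm (μ := leb) g).trans (integral_norm_le g)
    norm_num
    linarith
  have hi : ∫ y, ‖g y - mean g‖ ∂leb ≤ 4 * ‖g‖ := by
    calc ∫ y, ‖g y - mean g‖ ∂leb ≤ ∫ y, (‖g y‖ + ‖mean g‖) ∂leb :=
          integral_mono (integrable_sub_mean g).norm
            ((integrable_coe g).norm.add (integrable_const _)) fun y => norm_sub_le _ _
      _ = ∫ y, ‖g y‖ ∂leb + 2 * ‖mean g‖ := by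
          rw [integral_add (integrable_coe g).norm (integrable_const _), integral_const]
          simp [leb, Measure.real]; norm_num
      _ ≤ 4 * ‖g‖ := by linarith [integral_norm_le g]
  have hs : ∀ s : Set ℝ, ‖∫ y in s, (g y - mean g) ∂leb‖ ≤ 4 * ‖g‖ := fun s =>
    (norm_integral_le_integral_norm _).trans ((setIntegral_le_integral
      (integrable_sub_mean g).norm (Eventually.of_forall fun _ => norm_nonneg _)).trans hi)
  unfold D0inv
  refine (norm_sub_le _ _).trans ?_
  rw [norm_smul, norm_smul, show ‖(1 / 2 : ℝ)‖ = 1 / 2 by norm_num]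
  have h1 := hs (Ico (-1) x)
  have h2 := hs (Icc x 1)
  linarith

lemma measurable_D0inv_apply (g : Hil) (i : Fin 2) : StronglyMeasurable fun y => D0inv g y i :=
  (EuclideanSpace.proj (𝕜 := ℂ) i).continuous.comp_stronglyMeasurable (stronglyMeasurable_D0inv g)

lemma norm_D0inv_apply_le (g : Hil) (i : Fin 2) (y : ℝ) : ‖D0inv g y i‖ ≤ 4 * ‖g‖ :=
  (PiLp.norm_apply_le _ i).trans (norm_D0inv_le g y)

section D1

variable {r : Measure ℝ} {ψ ψ' : ℝ → ℂ} {B : ℝ}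

lemma stronglyMeasurable_weight_left (h : StronglyMeasurable ψ) :
    StronglyMeasurable fun y => (y + 1) • ψ y :=
  (measurable_id.add_const 1).stronglyMeasurable.smul h

lemma stronglyMeasurable_weight_right (h : StronglyMeasurable ψ) :
    StronglyMeasurable fun y => (y - 1) • ψ y :=
  (measurable_id.sub_const 1).stronglyMeasurable.smul h

lemma norm_weight_left (hB : ∀ y, ‖ψ y‖ ≤ B) {x y : ℝ} (hx : x ≤ 1) (hy : y ∈ Ico (-1) x) :
    ‖(y + 1) • ψ y‖ ≤ 2 * B := by
  rw [norm_smul]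
  have : ‖y + 1‖ ≤ 2 := by
    rw [Real.norm_eq_abs, abs_le]; constructor <;> linarith [hy.1, hy.2]
  exact mul_le_mul this (hB y) (norm_nonneg _) (by norm_num)

lemma norm_weight_right (hB : ∀ y, ‖ψ y‖ ≤ B) {x y : ℝ} (hx : -1 ≤ x) (hy : y ∈ Icc x 1) :
    ‖(y - 1) • ψ y‖ ≤ 2 * B := by
  rw [norm_smul]
  have : ‖y - 1‖ ≤ 2 := by
    rw [Real.norm_eq_abs, abs_le]; constructor <;> linarith [hy.1, hy.2]
  exact mul_le_mul this (hB y) (norm_nonneg _) (by norm_num)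

lemma integrableOn_left [IsFiniteMeasure r] (h : StronglyMeasurable ψ) (hB : ∀ y, ‖ψ y‖ ≤ B) {x : ℝ} (hx : x ≤ 1) :
    IntegrableOn (fun y => (y + 1) • ψ y) (Ico (-1) x) r :=
  Integrable.of_bound (stronglyMeasurable_weight_left h).aestronglyMeasurable (2 * B)
    ((ae_restrict_iff' measurableSet_Ico).2 (Eventually.of_forall fun _ hy =>
      norm_weight_left hB hx hy))

lemma integrableOn_right [IsFiniteMeasure r] (h : StronglyMeasurable ψ) (hB : ∀ y, ‖ψ y‖ ≤ B) {x : ℝ} (hx : -1 ≤ x) :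
    IntegrableOn (fun y => (y - 1) • ψ y) (Icc x 1) r :=
  Integrable.of_bound (stronglyMeasurable_weight_right h).aestronglyMeasurable (2 * B)
    ((ae_restrict_iff' measurableSet_Icc).2 (Eventually.of_forall fun _ hy =>
      norm_weight_right hB hx hy))

lemma D1inv_add {B' : ℝ} [IsFiniteMeasure r] (h : StronglyMeasurable ψ) (hB : ∀ y, ‖ψ y‖ ≤ B)
    (h' : StronglyMeasurable ψ') (hB' : ∀ y, ‖ψ' y‖ ≤ B') {x : ℝ} (hx : x ∈ Icc (-1) 1) :
    D1inv r (fun y => ψ y + ψ' y) x = D1inv r ψ x + D1inv r ψ' x := by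
  unfold D1inv
  simp only [smul_add]
  rw [integral_add (integrableOn_left h hB hx.2) (integrableOn_left h' hB' hx.2),
    integral_add (integrableOn_right h hB hx.1) (integrableOn_right h' hB' hx.1), smul_add,
    smul_add]
  abel

lemma D1inv_smul (c : ℂ) (x : ℝ) :
    D1inv r (fun y => c • ψ y) x = c • D1inv r ψ x := by
  unfold D1inv
  simp only [smul_comm _ c]
  rw [integral_smul, integral_smul, smul_comm _ c, smul_comm _ c, smul_add]

lemma norm_D1inv_le [IsFiniteMeasure r] (hB : ∀ y, ‖ψ y‖ ≤ B) {x : ℝ} (hx : x ∈ Icc (-1) 1) :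
    ‖D1inv r ψ x‖ ≤ 2 * B * r.real univ := by
  have hB0 : 0 ≤ 2 * B := by linarith [(norm_nonneg _).trans (hB 0)]
  have h1 : ‖∫ y in Ico (-1) x, (y + 1) • ψ y ∂r‖ ≤ 2 * B * r.real univ :=
    (norm_setIntegral_le_of_norm_le_const (measure_lt_top r _) fun y hy =>
      norm_weight_left hB hx.2 hy).trans
      (mul_le_mul_of_nonneg_left (measureReal_mono (subset_univ _)) hB0)
  have h2 : ‖∫ y in Icc x 1, (y - 1) • ψ y ∂r‖ ≤ 2 * B * r.real univ :=
    (norm_setIntegral_le_of_norm_le_const (measure_lt_top r _) fun y hy =>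
      norm_weight_right hB hx.1 hy).trans
      (mul_le_mul_of_nonneg_left (measureReal_mono (subset_univ _)) hB0)
  unfold D1inv
  refine (norm_add_le _ _).trans ?_
  rw [norm_smul, norm_smul, show ‖(1 / 2 : ℝ)‖ = 1 / 2 by norm_num]
  linarith

lemma stronglyMeasurable_D1inv [IsFiniteMeasure r] (h : StronglyMeasurable ψ) : StronglyMeasurable (D1inv r ψ) :=
  ((stronglyMeasurable_setIntegral r (fun x => Ico (-1) x) measurableSet_left _
      (stronglyMeasurable_weight_left h).aestronglyMeasurable).const_smul (1 / 2 : ℝ)).add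
    ((stronglyMeasurable_setIntegral r (fun x => Icc x 1) measurableSet_right _
      (stronglyMeasurable_weight_right h).aestronglyMeasurable).const_smul (1 / 2 : ℝ))

end D1

section T

variable (m n : Measure ℝ)

lemma Tfun_smul (c : ℂ) (f : Hil) (x : ℝ) : Tfun m n (c • f) x = c • Tfun m n f x := by
  unfold Tfun
  simp only [D0inv_smul, PiLp.smul_apply]
  rw [D1inv_smul, D1inv_smul]
  ext i
  fin_cases i <;> simp

variable [IsFiniteMeasure m] [IsFiniteMeasure n]

lemma stronglyMeasurable_Tfun (f : Hil) : StronglyMeasurable (Tfun m n f) := by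
  have h : StronglyMeasurable fun x =>
      ![D1inv n (fun y => D0inv f y 1) x, D1inv m (fun y => D0inv f y 0) x] := by
    refine (measurable_pi_lambda _ fun i => ?_).stronglyMeasurable
    fin_cases i
    · exact (stronglyMeasurable_D1inv (measurable_D0inv_apply f 1)).measurable
    · exact (stronglyMeasurable_D1inv (measurable_D0inv_apply f 0)).measurable
  exact (PiLp.continuous_toLp 2 _).comp_stronglyMeasurable h

lemma norm_Tfun_le (f : Hil) {x : ℝ} (hx : x ∈ Icc (-1 : ℝ) 1) :
    ‖Tfun m n f x‖ ≤ (8 * (n.real univ + m.real univ)) * ‖f‖ := by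
  have h1 := norm_D1inv_le (r := n) (norm_D0inv_apply_le f 1) hx
  have h2 := norm_D1inv_le (r := m) (norm_D0inv_apply_le f 0) hx
  have h3 : ‖Tfun m n f x‖ ≤ ‖D1inv n (fun y => D0inv f y 1) x‖
      + ‖D1inv m (fun y => D0inv f y 0) x‖ := by
    rw [Tfun, EuclideanSpace.norm_eq, Fin.sum_univ_two]
    refine Real.sqrt_le_iff.2 ⟨by positivity, ?_⟩
    simp only [Matrix.cons_val_zero, Matrix.cons_val_one]
    nlinarith [norm_nonneg (D1inv n (fun y => D0inv f y 1) x),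
      norm_nonneg (D1inv m (fun y => D0inv f y 0) x)]
  linarith

lemma ae_norm_Tfun_le (f : Hil) :
    ∀ᵐ x ∂leb, ‖Tfun m n f x‖ ≤ (8 * (n.real univ + m.real univ)) * ‖f‖ :=
  (ae_restrict_iff' measurableSet_Icc).2 (Eventually.of_forall fun _ hx => norm_Tfun_le m n f hx)

lemma memLp_Tfun (f : Hil) : MemLp (Tfun m n f) 2 leb :=
  MemLp.of_bound (stronglyMeasurable_Tfun m n f).aestronglyMeasurable _ (ae_norm_Tfun_le m n f)

lemma Tfun_add (f g : Hil) {x : ℝ} (hx : x ∈ Icc (-1 : ℝ) 1) :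
    Tfun m n (f + g) x = Tfun m n f x + Tfun m n g x := by
  unfold Tfun
  simp only [D0inv_add, PiLp.add_apply]
  rw [D1inv_add (measurable_D0inv_apply f 1) (norm_D0inv_apply_le f 1)
      (measurable_D0inv_apply g 1) (norm_D0inv_apply_le g 1) hx,
    D1inv_add (measurable_D0inv_apply f 0) (norm_D0inv_apply_le f 0)
      (measurable_D0inv_apply g 0) (norm_D0inv_apply_le g 0) hx]
  ext i
  fin_cases i <;> simp

/-- The bounded operator `T = D₁⁻¹ M D₀⁻¹` on `L²([-1, 1]; ℂ²)`. -/
def T : Hil →L[ℂ] Hil :=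
  LinearMap.mkContinuous
    { toFun := fun f => (memLp_Tfun m n f).toLp (Tfun m n f)
      map_add' := fun f g => by
        rw [← MemLp.toLp_add, MemLp.toLp_eq_toLp_iff]
        exact (ae_restrict_iff' measurableSet_Icc).2
          (Eventually.of_forall fun _ hx => Tfun_add m n f g hx)
      map_smul' := fun c f => by
        rw [RingHom.id_apply, ← MemLp.toLp_const_smul, MemLp.toLp_eq_toLp_iff]
        exact Eventually.of_forall fun x => Tfun_smul m n c f x }
    ((leb.real univ) ^ ((2 : ℝ≥0∞).toReal)⁻¹ * (8 * (n.real univ + m.real univ)))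
    (fun f => by
      rw [mul_assoc]
      refine Lp.norm_le_of_ae_bound (by positivity) ?_
      filter_upwards [(memLp_Tfun m n f).coeFn_toLp, ae_norm_Tfun_le m n f] with x h1 h2
      exact (congrArg norm h1).le.trans h2)

/-- The operator `R_l = I - (I - l T)⁻¹` (meaningful when `I - l T` is invertible). -/
def R (l : ℂ) : Hil →L[ℂ] Hil := 1 - Ring.inverse (1 - l • T m n)

end T

/-- The indefinite form `⟨f, g⟩ = ∫ (f₁ conj g₂ + f₂ conj g₁) dx`. -/
def form (f g : Hil) : ℂ := ∫ x, (f x 0 * conj (g x 1) + f x 1 * conj (g x 0)) ∂leb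

/-- The integral kernel of the operator `h ↦ (⟨h, f⟩ / ⟨f, f⟩) f`. For real `f` the conjugations
have no effect. -/
def projKernel (f : Hil) (p : ℝ × ℝ) : Matrix (Fin 2) (Fin 2) ℂ :=
  (form f f)⁻¹ • !![f p.1 0 * conj (f p.2 1), f p.1 0 * conj (f p.2 0);
                    f p.1 1 * conj (f p.2 1), f p.1 1 * conj (f p.2 0)]

/-- `K ∈ L²([-1, 1]²; M(2, ℂ))` is the integral kernel of the operator `A`. -/
def IsKernel (K : ℝ × ℝ → Matrix (Fin 2) (Fin 2) ℂ) (A : Hil →L[ℂ] Hil) : Prop :=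
  MemLp K 2 (leb.prod leb) ∧
    ∀ f : Hil, ∀ᵐ x ∂leb, A f x = ∫ y, WithLp.toLp 2 (Matrix.mulVec (K (x, y)) (f y)) ∂leb

end Beam

/-! Let `J` interchange the two components, so that the indefinite form is ⟨f, g⟩ = ⟪J g, f⟫.
Integration by parts, in the form D₁⁻¹ = -(D₀⁻¹)*, shows that Q = -J T is nonnegative: ⟪f, Q f⟫ = ∫
|φ₂|² dn + ∫ |φ₁|² dm with φ = D₀⁻¹ f. Hence Q = q² with q symmetric, and T = -J q². The operator T
need not be symmetric for the Hilbert space inner product, but q T = S q with S = -q J q symmetric.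
So if T x = t x with t ≠ 0, then q x is an eigenvector of S; therefore t is real, different
eigenvalues give orthogonal vectors q x, and t ⟪J x, x⟫ = -‖q x‖² is not zero.

Convergence rests on one identity. If P is the projection onto the line of x that is orthogonal for
the form, then |t| ‖P‖ = ‖q u‖², where u is the unit vector along q x. Evaluation of D₀⁻¹ f at a
point is a bounded functional of f and m, n are finite, so q is Hilbert-Schmidt, and the sum of ‖q
u‖² over the orthonormal vectors u is finite. Since P has rank one, its operator norm is also the L²
norm of its kernel: the series converges absolutely as a series of kernels.

For completeness, the spectral theorem for the compact operator S shows that a vector orthogonal to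
all eigenvectors q x is killed by q J q. Mutual absolute continuity of m and n makes the kernel of q
invariant under `J`, so the vector is killed by q itself. This gives T = ∑ P_ν / λ_ν
(`IsEigenSystem.hasSum_op`), and the resolvent is then checked term by term
(`IsEigenSystem.resolvent`).

One eigenfunction per eigenvalue is enough because eigenspaces are one-dimensional
(`exists_smul_of_eigenvectors`). A solution vanishing at -1 is determined by its two initial slopes.
Two eigenfunctions with independent slopes would combine to one with slopes 1 and sign λ; up to that
sign its components stay nonnegative, and the first cannot return to 0 at the point 1. These facts
are assembled in `isEigenSystem`, and `exists_kernel_of_summable` passes from operators to kernels.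
-/

namespace Beam

/-! ### Spectral theory of operators -J q² with q Hilbert-Schmidt. -/

section Abstract

open InnerProductSpace
open scoped InnerProductSpace

variable {H : Type} [NormedAddCommGroup H] [InnerProductSpace ℂ H]

/-- The sums of `‖A e‖²` over finite orthonormal families are bounded by `C`. -/
def HSBound (A : H →L[ℂ] H) (C : ℝ) : Prop :=
  ∀ (κ : Type) [Fintype κ] (e : κ → H), Orthonormal ℂ e → ∑ i, ‖A (e i)‖ ^ 2 ≤ C

/-- For a Hilbert-Schmidt operator `A`, there are finite-dimensional subspaces on whose orthogonal
complement `A` is as small as desired. -/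
theorem HSBound.exists_small {A : H →L[ℂ] H} {C : ℝ} (hA : HSBound A C) {ε : ℝ} (hε : 0 < ε) :
    ∃ V : Submodule ℂ H, FiniteDimensional ℂ V ∧ ∀ y ∈ Vᗮ, ‖A y‖ ≤ ε * ‖y‖ := by
  classical
  let S : Set ℝ := {x | ∃ (k : ℕ) (e : Fin k → H), Orthonormal ℂ e ∧ ∑ i, ‖A (e i)‖ ^ 2 = x}
  have hne : S.Nonempty := ⟨0, 0, Fin.elim0, ⟨fun i => i.elim0, fun i => i.elim0⟩, by simp⟩
  have hbd : BddAbove S := ⟨C, by rintro _ ⟨k, e, he, rfl⟩; exact hA _ e he⟩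
  -- A finite family that comes within ε² of the supremum: adjoining a unit vector u orthogonal to
  -- it cannot exceed the supremum, so ‖A u‖² is less than ε².
  obtain ⟨_, ⟨k, e, he, rfl⟩, hlt⟩ := exists_lt_of_lt_csSup hne
    (show sSup S - ε ^ 2 < sSup S by have := pow_pos hε 2; linarith)
  refine ⟨Submodule.span ℂ (range e), FiniteDimensional.span_of_finite ℂ (finite_range e),
    fun y hy => ?_⟩
  rcases eq_or_ne y 0 with rfl | hy0
  · simp
  have hyn : ‖y‖ ≠ 0 := norm_ne_zero_iff.2 hy0
  have hye : ∀ i, ⟪e i, y⟫_ℂ = 0 := fun i => hy _ (Submodule.subset_span ⟨i, rfl⟩)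
  let u : H := ((‖y‖⁻¹ : ℝ) : ℂ) • y
  have hu : ‖u‖ = 1 := by
    simp only [u, norm_smul, Complex.norm_real, norm_inv, norm_norm]
    exact inv_mul_cancel₀ hyn
  have hon : Orthonormal ℂ (Fin.cons u e : Fin (k + 1) → H) := by
    refine ⟨fun i => ?_, fun i j hij => ?_⟩
    · refine Fin.cases ?_ (fun i => ?_) i
      · simpa using hu
      · simpa using he.1 i
    · have h1 : ∀ i, ⟪e i, u⟫_ℂ = 0 := fun i => by rw [inner_smul_right, hye, mul_zero]
      have h2 : ∀ i, ⟪u, e i⟫_ℂ = 0 := fun i => by rw [← inner_conj_symm, h1, map_zero]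
      revert hij
      refine Fin.cases ?_ (fun i => ?_) i <;> refine Fin.cases ?_ (fun j => ?_) j
      · simp
      · intro _; simpa using h2 j
      · intro _; simpa using h1 i
      · intro hij; simpa using he.2 (fun h => hij (by rw [h]))
  have hle : ∑ i, ‖A ((Fin.cons u e : Fin (k + 1) → H) i)‖ ^ 2 ≤ sSup S :=
    le_csSup hbd ⟨k + 1, _, hon, rfl⟩
  rw [Fin.sum_univ_succ] at hle
  simp only [Fin.cons_zero, Fin.cons_succ] at hle
  have h3 : ‖A u‖ ≤ ε := by
    refine le_of_sq_le_sq ?_ hε.le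
    linarith
  have h4 : ‖A u‖ = ‖y‖⁻¹ * ‖A y‖ := by
    simp only [u, map_smul, norm_smul, Complex.norm_real, norm_inv, norm_norm]
  rw [h4, inv_mul_le_iff₀ (lt_of_le_of_ne (norm_nonneg _) hyn.symm)] at h3
  linarith

/-- Composition with the projections onto the subspaces of `HSBound.exists_small` gives finite-rank
operators that converge to `A` in norm, and the compact operators are closed. -/
theorem HSBound.isCompactOperator [CompleteSpace H] {A : H →L[ℂ] H} {C : ℝ} (hA : HSBound A C) :
    IsCompactOperator A := by
  refine (isClosed_setOfPred_isCompactOperator (σ₁₂ := RingHom.id ℂ) (M₁ := H) (M₂ := H)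
    ).closure_subset_iff.2 subset_rfl (Metric.mem_closure_iff.2 fun ε hε => ?_)
  obtain ⟨V, hV, hs⟩ := hA.exists_small (half_pos hε)
  refine ⟨A ∘L V.starProjection, ?_, ?_⟩
  · have h1 : IsCompactOperator (_root_.id : V → V) := isCompactOperator_id_iff_finiteDimensional.2 hV
    have h2 := (h1.comp_clm V.orthogonalProjectionOnto).clm_comp (A ∘L V.subtypeL)
    exact h2
  · rw [dist_eq_norm]
    refine lt_of_le_of_lt (ContinuousLinearMap.opNorm_le_bound _ (half_pos hε).le fun x => ?_)
      (half_lt_self hε)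
    have h1 : (A - A ∘L V.starProjection) x = A (x - V.starProjection x) := by simp
    rw [h1]
    have h2 : x - V.starProjection x ∈ Vᗮ := Submodule.sub_starProjection_mem_orthogonal x
    refine (hs _ h2).trans (mul_le_mul_of_nonneg_left ?_ (half_pos hε).le)
    have h3 : x - V.starProjection x = Vᗮ.starProjection x := by
      rw [Submodule.starProjection_orthogonal_val]
    rw [h3]
    exact Submodule.norm_starProjection_apply_le _ _

/-- The projection onto the line of `v` that is orthogonal for the form `⟪J g, f⟫`. -/
def formProj (J : H →L[ℂ] H) (v : H) : H →L[ℂ] H := (⟪J v, v⟫_ℂ)⁻¹ • rankOne ℂ v (J v)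

lemma formProj_apply (J : H →L[ℂ] H) (v h : H) :
    formProj J v h = (⟪J v, v⟫_ℂ)⁻¹ • ⟪J v, h⟫_ℂ • v := rfl

variable {J q T : H →L[ℂ] H}

section Eigen

variable (hJJ : ∀ x, J (J x) = x) (hJ : ∀ x y, ⟪J x, y⟫_ℂ = ⟪x, J y⟫_ℂ)
  (hq : ∀ x y, ⟪q x, y⟫_ℂ = ⟪x, q y⟫_ℂ) (hT : ∀ x, T x = -J (q (q x)))

include hJJ hJ in
lemma norm_involution (x : H) : ‖J x‖ = ‖x‖ := by
  have h : ⟪J x, J x⟫_ℂ = ⟪x, x⟫_ℂ := by rw [hJ, hJJ]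
  rw [inner_self_eq_norm_sq_to_K, inner_self_eq_norm_sq_to_K] at h
  have h' : ‖J x‖ ^ 2 = ‖x‖ ^ 2 := by exact_mod_cast h
  exact (sq_eq_sq₀ (norm_nonneg _) (norm_nonneg _)).1 h'

variable {t : ℂ} {x : H} (ht : t ≠ 0) (hx : x ≠ 0) (he : T x = t • x)

include hT ht hx he in
lemma sqrt_apply_ne_zero : q x ≠ 0 := by
  intro h
  rw [hT, h, map_zero, map_zero, neg_zero] at he
  exact (smul_ne_zero ht hx) he.symm

include hT he in
-- The intertwining relation q T = S q with the symmetric operator S = -q J q: everything that is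
-- true of eigenvectors of S is transported back through `q`.
lemma symm_eigen : -q (J (q (q x))) = t • q x := by
  rw [← map_neg, ← hT, he, map_smul]

include hJ hq hT ht hx he in
lemma conj_eigenvalue : conj t = t := by
  have h0 := sqrt_apply_ne_zero hT ht hx he
  have h1 : ⟪-q (J (q (q x))), q x⟫_ℂ = ⟪q x, -q (J (q (q x)))⟫_ℂ := by
    rw [inner_neg_left, inner_neg_right, hq, hJ, hq]
  rw [symm_eigen hT he, inner_smul_left, inner_smul_right] at h1
  exact mul_right_cancel₀ (inner_self_ne_zero.2 h0) h1

include hJJ hT he in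
lemma eigen_swap : t • J x = -q (q x) := by
  rw [← map_smul, ← he, hT, map_neg, hJJ]

include hJJ hJ hq hT ht hx he in
lemma eigen_form : t * ⟪J x, x⟫_ℂ = -((‖q x‖ ^ 2 : ℝ) : ℂ) := by
  have h1 : ⟪t • J x, x⟫_ℂ = -⟪q (q x), x⟫_ℂ := by
    rw [eigen_swap hJJ hT he, inner_neg_left]
  rw [inner_smul_left, conj_eigenvalue hJ hq hT ht hx he, hq, inner_self_eq_norm_sq_to_K] at h1
  rw [h1]; simp

include hJJ hJ hq hT ht hx he in
lemma eigen_form_ne_zero : ⟪J x, x⟫_ℂ ≠ 0 := by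
  intro h
  have h1 := eigen_form hJJ hJ hq hT ht hx he
  rw [h, mul_zero, eq_comm, neg_eq_zero, Complex.ofReal_eq_zero] at h1
  exact sqrt_apply_ne_zero hT ht hx he (norm_eq_zero.1 (pow_eq_zero_iff two_ne_zero |>.1 h1))

include hJJ hJ hq hT ht hx he in
-- The key identity behind convergence. By rank one, ‖P‖ = ‖x‖² / |⟪J x, x⟫| = |t| ‖x‖² / ‖q x‖²,
-- while q (q x) = -t J x has norm |t| ‖x‖. The right side is a term of a Hilbert-Schmidt sum of
-- `q`.
lemma eigen_norm_formProj : ‖t‖ * ‖formProj J x‖ =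
    ‖q (((‖q x‖⁻¹ : ℝ) : ℂ) • q x)‖ ^ 2 := by
  have h0 : ‖q x‖ ≠ 0 := norm_ne_zero_iff.2 (sqrt_apply_ne_zero hT ht hx he)
  have ht0 : ‖t‖ ≠ 0 := norm_ne_zero_iff.2 ht
  have h1 := congrArg norm (eigen_form hJJ hJ hq hT ht hx he)
  rw [norm_mul, norm_neg, Complex.norm_real, Real.norm_of_nonneg (by positivity)] at h1
  have h2 := congrArg norm (eigen_swap hJJ hT he)
  rw [norm_smul, norm_neg, norm_involution hJJ hJ] at h2
  have h3 : ‖⟪J x, x⟫_ℂ‖ = ‖q x‖ ^ 2 / ‖t‖ := by rw [← h1]; field_simp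
  rw [formProj, norm_smul, norm_inv, norm_rankOne, norm_involution hJJ hJ, map_smul, norm_smul,
    ← h2, h3, Complex.norm_real, norm_inv, norm_norm]
  field_simp

include hJJ hJ hq hT ht hx he in
-- The projection fixes `x`.
lemma one_le_norm_formProj : 1 ≤ ‖formProj J x‖ := by
  have h0 := eigen_form_ne_zero hJJ hJ hq hT ht hx he
  have h1 : formProj J x x = x := by
    rw [formProj_apply, smul_smul, inv_mul_cancel₀ h0, one_smul]
  have h2 := (formProj J x).le_opNorm x
  rw [h1] at h2
  exact le_of_mul_le_mul_right (by simpa using h2) (norm_pos_iff.2 hx)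

include hJJ hJ hq hT ht hx he in
-- `T` is symmetric for the form ⟪J g, f⟫ and `t` is real, so ⟪J x, T h⟫ = t ⟪J x, h⟫.
lemma formProj_comp_eigen : formProj J x * T = t • formProj J x := by
  ext h
  have h1 : ⟪J x, T h⟫_ℂ = t * ⟪J x, h⟫_ℂ := by
    rw [hT, inner_neg_right, ← hJ, hJJ, ← hq, ← hq, ← inner_neg_left,
      ← eigen_swap hJJ hT he, inner_smul_left, conj_eigenvalue hJ hq hT ht hx he]
  simp only [mul_apply_eq_comp, _root_.smul_apply, formProj_apply, h1,
    smul_smul]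
  congr 1; ring

include he in
lemma eigen_comp_formProj : T * formProj J x = t • formProj J x := by
  ext h
  simp only [mul_apply_eq_comp, _root_.smul_apply, formProj_apply,
    map_smul, he, smul_smul]
  congr 1; ring

end Eigen

/-- A complete system of eigenvectors of `T = -J q²`: `J` is a self-adjoint involution, `q` is a
symmetric Hilbert-Schmidt operator whose kernel is invariant under `J`, and the `v i` are
representatives of all the eigenlines for nonzero eigenvalues. -/
structure IsEigenSystem (J q T : H →L[ℂ] H) {ι : Type} (a : ι → ℂ) (v : ι → H) : Prop where
  invol : ∀ x, J (J x) = x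
  symmJ : ∀ x y, ⟪J x, y⟫_ℂ = ⟪x, J y⟫_ℂ
  symm : ∀ x y, ⟪q x, y⟫_ℂ = ⟪x, q y⟫_ℂ
  eq : ∀ x, T x = -J (q (q x))
  ker : ∀ x, q x = 0 → q (J x) = 0
  hs : ∃ C, HSBound q C
  inj : Function.Injective a
  ne : ∀ i, a i ≠ 0
  vec_ne : ∀ i, v i ≠ 0
  eigen : ∀ i, T (v i) = a i • v i
  complete : ∀ (t : ℂ) (x : H), t ≠ 0 → T x = t • x → x ≠ 0 → ∃ i, ∃ c : ℂ, x = c • v i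

variable {ι : Type} {a : ι → ℂ} {v : ι → H}

namespace IsEigenSystem

lemma orthonormal (h : IsEigenSystem J q T a v) :
    Orthonormal ℂ fun i => ((‖q (v i)‖⁻¹ : ℝ) : ℂ) • q (v i) := by
  have h0 := fun i => sqrt_apply_ne_zero h.eq (h.ne i) (h.vec_ne i) (h.eigen i)
  refine ⟨fun i => ?_, fun i j hij => ?_⟩
  · rw [norm_smul, Complex.norm_real, norm_inv, norm_norm, inv_mul_cancel₀ (norm_ne_zero_iff.2 (h0 i))]
  · simp only
    rw [inner_smul_left, inner_smul_right]
    have h1 : ⟪-q (J (q (q (v i)))), q (v j)⟫_ℂ = ⟪q (v i), -q (J (q (q (v j))))⟫_ℂ := by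
      rw [inner_neg_left, inner_neg_right, h.symm, h.symmJ, h.symm]
    rw [symm_eigen h.eq (h.eigen i), symm_eigen h.eq (h.eigen j), inner_smul_left,
      inner_smul_right, conj_eigenvalue h.symmJ h.symm h.eq (h.ne i) (h.vec_ne i) (h.eigen i)] at h1
    have h2 : (a i - a j) * ⟪q (v i), q (v j)⟫_ℂ = 0 := by rw [sub_mul, h1, sub_self]
    rcases mul_eq_zero.1 h2 with h3 | h3
    · exact absurd (h.inj (sub_eq_zero.1 h3)) hij
    · rw [h3, mul_zero, mul_zero]

/-- By `eigen_norm_formProj` the finite partial sums are sums of ‖q u‖² over orthonormal vectors u,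
bounded by the Hilbert-Schmidt bound of `q`. -/
lemma summable_norm (h : IsEigenSystem J q T a v) :
    Summable fun i => ‖a i‖ * ‖formProj J (v i)‖ := by
  obtain ⟨C, hC⟩ := h.hs
  refine summable_of_sum_le (c := C) (fun i => by positivity) fun s => ?_
  have h1 := hC s _ (h.orthonormal.comp ((↑) : s → ι) Subtype.coe_injective)
  refine le_trans (le_of_eq ?_) h1
  rw [← Finset.sum_coe_sort]
  exact Finset.sum_congr rfl fun i _ => eigen_norm_formProj h.invol h.symmJ h.symm h.eq
    (h.ne i) (h.vec_ne i) (h.eigen i)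

lemma summable_norm_eigenvalue (h : IsEigenSystem J q T a v) : Summable fun i => ‖a i‖ := by
  refine h.summable_norm.of_nonneg_of_le (fun i => norm_nonneg _) fun i => ?_
  exact le_mul_of_one_le_right (norm_nonneg _) (one_le_norm_formProj h.invol h.symmJ h.symm h.eq
    (h.ne i) (h.vec_ne i) (h.eigen i))

lemma isCompactOperator_symm [CompleteSpace H] (h : IsEigenSystem J q T a v) :
    IsCompactOperator (-(q * J * q)) := by
  obtain ⟨C, hC⟩ := h.hs
  exact (hC.isCompactOperator.clm_comp (q * J)).neg

/-- Vectors orthogonal to all the `q (v i)` are annihilated by `q`. -/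
lemma ker_of_orthogonal [CompleteSpace H] (h : IsEigenSystem J q T a v) {z : H}
    (hz : ∀ i, ⟪q (v i), z⟫_ℂ = 0) : q z = 0 := by
  set S : H →L[ℂ] H := -(q * J * q) with hS
  have hSa : ∀ x, S x = -q (J (q x)) := fun x => rfl
  have hsymm : S.IsSymmetric := fun x y => by
    change ⟪S x, y⟫_ℂ = ⟪x, S y⟫_ℂ
    rw [hSa, hSa, inner_neg_left, inner_neg_right, h.symm, h.symmJ, h.symm]
  have hspec := ContinuousLinearMap.orthogonalComplement_iSup_eigenspaces_eq_bot
    h.isCompactOperator_symm hsymm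
  have hz0 : S z = 0 := by
    -- By the spectral theorem it suffices that S z is orthogonal to every eigenvector y of S.
    -- Eigenvalue zero is trivial, since ⟪y, S z⟫ = ⟪S y, z⟫.
    rw [← Submodule.mem_bot ℂ, ← hspec, ← Submodule.iInf_orthogonal, Submodule.mem_iInf]
    intro t y hy
    have hy' : S y = t • y := Module.End.mem_eigenspace_iff.1 hy
    have h1 : ⟪y, S z⟫_ℂ = conj t * ⟪y, z⟫_ℂ := by
      rw [← inner_smul_left, ← hy']; exact (hsymm y z).symm
    rw [h1]
    rcases eq_or_ne t 0 with rfl | ht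
    · simp
    rcases eq_or_ne y 0 with rfl | hy0
    · simp
    have hqx : q (-J (q y)) = t • y := by rw [map_neg, ← hSa, hy']
    -- The intertwining is reversed: -J (q y) is an eigenvector of `T`, and `q` maps it to t y. So y
    -- is a multiple of some q (v i).
    obtain ⟨i, c, hc⟩ := h.complete t (-J (q y)) ht
      (by rw [h.eq, hqx, map_smul, map_smul, smul_neg])
      (fun h0 => smul_ne_zero ht hy0 (by rw [← hqx, h0, map_zero]))
    rw [hc, map_smul] at hqx
    have h2 : conj t * ⟪y, z⟫_ℂ = 0 := by
      rw [← inner_smul_left, ← hqx, inner_smul_left, hz, mul_zero]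
    rw [h2]
  -- Invariance of the kernel under `J` turns q J q z = 0 into q² z = 0. Without it `T` could have a
  -- nilpotent part, as in the case m = 0, where T² = 0.
  have h1 : q (J (q z)) = 0 := by rw [hSa, neg_eq_zero] at hz0; exact hz0
  have h2 := h.ker _ h1
  rw [h.invol] at h2
  have h3 : ⟪q z, q z⟫_ℂ = 0 := by rw [h.symm, h2, inner_zero_right]
  exact inner_self_eq_zero.1 h3

/-- The spectral expansion of `T`. -/
theorem hasSum_apply [CompleteSpace H] (h : IsEigenSystem J q T a v) (x : H) :
    HasSum (fun i => a i • formProj J (v i) x) (T x) := by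
  set u : ι → H := fun i => ((‖q (v i)‖⁻¹ : ℝ) : ℂ) • q (v i) with hu
  have hon : Orthonormal ℂ u := h.orthonormal
  have hsum : Summable fun i => ⟪u i, q x⟫_ℂ • u i := by
    have h1 := hon.orthogonalFamily.summable_iff_norm_sq_summable (fun i => ⟪u i, q x⟫_ℂ)
    refine h1.2 ?_
    exact hon.inner_products_summable (q x)
  obtain ⟨w, hw⟩ := hsum
  -- The vectors u i need not span, so the Bessel sum w may differ from q x; but the difference is
  -- orthogonal to all of them and hence invisible to `q`, which is all that T x = -J q (q x) needs.
  have hz : q (q x - w) = 0 := by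
    refine h.ker_of_orthogonal fun i => ?_
    have h0 := norm_ne_zero_iff.2 (sqrt_apply_ne_zero h.eq (h.ne i) (h.vec_ne i) (h.eigen i))
    have h1 : ⟪u i, w⟫_ℂ = ⟪u i, q x⟫_ℂ := by
      have h2 := hw.mapL (innerSL ℂ (u i))
      have h3 : HasSum (fun j => innerSL ℂ (u i) (⟪u j, q x⟫_ℂ • u j)) ⟪u i, q x⟫_ℂ := by
        convert hasSum_single i fun j hj => ?_ using 1
        · simp [inner_self_eq_norm_sq_to_K, hon.1 i]
        · simp [hon.2 (Ne.symm hj)]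
      exact h2.unique h3
    have h4 : ⟪u i, q x - w⟫_ℂ = 0 := by rw [inner_sub_right, h1, sub_self]
    rw [hu] at h4
    simp only at h4
    rw [inner_smul_left] at h4
    refine (mul_eq_zero.1 h4).resolve_left ?_
    simpa using h0
  have hTx : T x = (-(J * q)) w := by
    rw [map_sub, sub_eq_zero] at hz
    rw [h.eq, hz]; rfl
  rw [hTx]
  -- Applying -J q to u i gives a multiple of v i; the normalising factor ‖q (v i)‖² is -a i ⟪J (v
  -- i), v i⟫, and this produces the denominator of `formProj`.
  convert hw.mapL (-(J * q)) using 2 with i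
  have h0 : (‖q (v i)‖ : ℂ) ≠ 0 := by
    exact_mod_cast norm_ne_zero_iff.2 (sqrt_apply_ne_zero h.eq (h.ne i) (h.vec_ne i) (h.eigen i))
  have ha := h.ne i
  have h1 := eigen_form h.invol h.symmJ h.symm h.eq (h.ne i) (h.vec_ne i) (h.eigen i)
  have h1' := eigen_form_ne_zero h.invol h.symmJ h.symm h.eq (h.ne i) (h.vec_ne i) (h.eigen i)
  have h2 : a i * ⟪J (v i), x⟫_ℂ = -⟪q (v i), q x⟫_ℂ := by
    have h3 := congrArg (fun y => ⟪y, x⟫_ℂ) (eigen_swap h.invol h.eq (h.eigen i))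
    simp only [inner_smul_left, inner_neg_left] at h3
    rwa [conj_eigenvalue h.symmJ h.symm h.eq (h.ne i) (h.vec_ne i) (h.eigen i), h.symm] at h3
  have h4 : (-(J * q)) (u i) = ((‖q (v i)‖⁻¹ : ℝ) : ℂ) • a i • v i := by
    rw [map_smul, ← h.eigen i, h.eq]; rfl
  rw [map_smul, h4, formProj_apply, hu]
  simp only [inner_smul_left, smul_smul]
  congr 1
  simp only [Complex.ofReal_inv, map_inv₀, Complex.conj_ofReal]
  push_cast at h1
  have h5 : ⟪q (v i), q x⟫_ℂ = -(a i * ⟪J (v i), x⟫_ℂ) := by rw [h2, neg_neg]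
  rw [h5]
  field_simp
  linear_combination ⟪J (v i), x⟫_ℂ * h1

theorem hasSum_op [CompleteSpace H] (h : IsEigenSystem J q T a v) :
    HasSum (fun i => a i • formProj J (v i)) T := by
  have hs : Summable fun i => a i • formProj J (v i) :=
    Summable.of_norm (by simpa only [norm_smul] using h.summable_norm)
  convert hs.hasSum
  ext x
  have h2 := hs.hasSum.mapL (ContinuousLinearMap.apply ℂ H x)
  exact (h.hasSum_apply x).unique h2

/-- The resolvent expansion, for coefficients `l / (l - 1 / a i)`. -/
theorem resolvent [CompleteSpace H] (h : IsEigenSystem J q T a v) {l : ℂ}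
    (hl : ∀ i, l * a i ≠ 1) :
    (Summable fun i => ‖l / (l - (a i)⁻¹)‖ * ‖formProj J (v i)‖) ∧
    (1 - l • T) * (1 - ∑' i, (l / (l - (a i)⁻¹)) • formProj J (v i)) = 1 ∧
    (1 - ∑' i, (l / (l - (a i)⁻¹)) • formProj J (v i)) * (1 - l • T) = 1 := by
  set c : ι → ℂ := fun i => l / (l - (a i)⁻¹) with hc
  -- This says (1 - l a)(1 - c) = 1, the scalar form of the resolvent identity.
  have hc' : ∀ i, l * a i + c i - l * (a i * c i) = 0 := fun i => by
    have h1 := h.ne i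
    have h2 : l - (a i)⁻¹ ≠ 0 := fun h0 => hl i (by
      rw [sub_eq_zero.1 h0, inv_mul_cancel₀ h1])
    have h3 : l * a i - 1 ≠ 0 := sub_ne_zero.2 (hl i)
    have h4 : c i = l * a i / (l * a i - 1) := by
      rw [hc, div_eq_div_iff h2 h3]
      field_simp
    rw [h4]
    field_simp
    ring
  have hsc : Summable fun i => ‖c i‖ * ‖formProj J (v i)‖ := by
    -- The eigenvalues a i are summable, hence |l a i| < 1/2 for all but finitely many i, and there
    -- c = l a / (l a - 1) has |c| ≤ 2 |l a|.
    refine (h.summable_norm.mul_left (2 * ‖l‖)).of_norm_bounded_eventually ?_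
    have h1 := (h.summable_norm_eigenvalue.mul_left ‖l‖).tendsto_cofinite_zero
    filter_upwards [h1.eventually (gt_mem_nhds (show (0 : ℝ) < 1 / 2 by norm_num))] with i hi
    rw [Real.norm_of_nonneg (by positivity), ← mul_assoc]
    refine mul_le_mul_of_nonneg_right ?_ (norm_nonneg _)
    have h2 : c i * (l * a i - 1) = l * a i := by linear_combination -hc' i
    have h3 : 1 / 2 ≤ ‖l * a i - 1‖ := by
      have h4 := norm_sub_norm_le (1 : ℂ) (l * a i)
      rw [norm_one, norm_sub_rev, norm_mul] at h4
      linarith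
    have h5 := congrArg norm h2
    rw [norm_mul, norm_mul] at h5
    nlinarith [norm_nonneg (c i)]
  have hs : HasSum (fun i => c i • formProj J (v i)) (∑' i, c i • formProj J (v i)) :=
    (Summable.of_norm (by simpa only [norm_smul] using hsc)).hasSum
  have h1 := (h.hasSum_op.const_smul l).add hs
  -- Both products l T P and P l T have this expansion, because each single projection satisfies T
  -- P_i = P_i T = a i P_i; mutual orthogonality of the projections is not needed.
  have key : ∀ X : H →L[ℂ] H, HasSum (fun i => (l * a i * c i) • formProj J (v i)) X →
      l • T + ∑' i, c i • formProj J (v i) - X = 0 := fun X hX => by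
    refine (h1.sub hX).unique ?_
    convert hasSum_zero with i
    rw [smul_smul, ← add_smul, ← sub_smul, mul_assoc, hc', zero_smul]
  set P := ∑' i, c i • formProj J (v i) with hP
  refine ⟨hsc, ?_, ?_⟩
  · have h2 : (fun i => (l • T) * (c i • formProj J (v i)))
        = fun i => (l * a i * c i) • formProj J (v i) := funext fun i => by
      rw [smul_mul_smul_comm, eigen_comp_formProj (h.eigen i), smul_smul]
      congr 1; ring
    have h3 := key ((l • T) * P) (h2 ▸ hs.mul_left (l • T))
    have h4 : (1 - l • T) * (1 - P) = 1 - (l • T + P - (l • T) * P) := by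
      simp only [sub_mul, mul_sub, one_mul, mul_one]; abel
    rw [h4, h3, sub_zero]
  · have h2 : (fun i => (c i • formProj J (v i)) * (l • T))
        = fun i => (l * a i * c i) • formProj J (v i) := funext fun i => by
      rw [smul_mul_smul_comm, formProj_comp_eigen h.invol h.symmJ h.symm h.eq
        (h.ne i) (h.vec_ne i) (h.eigen i), smul_smul]
      congr 1; ring
    have h3 := key (P * (l • T)) (h2 ▸ hs.mul_right (l • T))
    have h4 : (1 - P) * (1 - l • T) = 1 - (l • T + P - P * (l • T)) := by
      simp only [sub_mul, mul_sub, one_mul, mul_one]; abel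
    rw [h4, h3, sub_zero]

end IsEigenSystem

end Abstract

/-! ### Integral formulas for D₀⁻¹ and D₁⁻¹ and their adjointness. -/

section Integration

lemma leb_compl : leb (Icc (-1) 1)ᶜ = 0 := by simp [leb]

lemma ae_mem_Icc {r : Measure ℝ} (hr : r (Icc (-1) 1)ᶜ = 0) : ∀ᵐ x ∂r, x ∈ Icc (-1 : ℝ) 1 :=
  mem_ae_iff.2 hr

lemma leb_real_Iic {x : ℝ} (hx : x ∈ Icc (-1 : ℝ) 1) : leb.real (Iic x) = x + 1 := by
  have h : Iic x ∩ Icc (-1) 1 = Icc (-1) x := by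
    ext y; simp only [mem_inter_iff, mem_Iic, mem_Icc]
    constructor
    · rintro ⟨h1, h2, -⟩; exact ⟨h2, h1⟩
    · rintro ⟨h1, h2⟩; exact ⟨h2, h1, h2.trans hx.2⟩
  rw [measureReal_def, leb, Measure.restrict_apply measurableSet_Iic, h, Real.volume_Icc,
    ENNReal.toReal_ofReal (by linarith [hx.1])]
  ring

lemma leb_real_univ : leb.real univ = 2 := by
  simp [measureReal_def, leb]; norm_num

/-- Interchange of the order of integration over the triangle `x ≤ y`. -/
lemma integral_integral_Ici_mul (r s : Measure ℝ) [SFinite r] [SFinite s] {ψ h : ℝ → ℂ}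
    (hψ : Integrable ψ r) (hh : Integrable h s) :
    ∫ x, (∫ y in Ici x, ψ y ∂r) * h x ∂s = ∫ y, ψ y * ∫ x in Iic y, h x ∂s ∂r := by
  let A : Set (ℝ × ℝ) := {p | p.1 ≤ p.2}
  have hA : MeasurableSet A := measurableSet_le measurable_fst measurable_snd
  have hint : Integrable (A.indicator fun p : ℝ × ℝ => h p.1 * ψ p.2) (s.prod r) :=
    (hh.mul_prod hψ).indicator hA
  have h1 : ∀ x, (∫ y in Ici x, ψ y ∂r) * h x
      = ∫ y, A.indicator (fun p : ℝ × ℝ => h p.1 * ψ p.2) (x, y) ∂r := fun x => by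
    rw [mul_comm, ← integral_const_mul, ← integral_indicator measurableSet_Ici]
    rfl
  have h2 : ∀ y, ψ y * ∫ x in Iic y, h x ∂s
      = ∫ x, A.indicator (fun p : ℝ × ℝ => h p.1 * ψ p.2) (x, y) ∂s := fun y => by
    rw [mul_comm, ← integral_mul_const, ← integral_indicator measurableSet_Iic]
    rfl
  simp only [h1, h2]
  exact integral_integral_swap (f := fun x y => A.indicator (fun p : ℝ × ℝ => h p.1 * ψ p.2) (x, y))
    hint

lemma integrable_weight {r : Measure ℝ} (hr : r (Icc (-1) 1)ᶜ = 0) {ψ : ℝ → ℂ}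
    (hψ : Integrable ψ r) (c : ℝ) : Integrable (fun y => (y + c) • ψ y) r := by
  refine hψ.bdd_smul (φ := fun y => y + c) (1 + |c|) (by fun_prop) ?_
  filter_upwards [ae_mem_Icc hr] with y hy
  refine (norm_add_le _ _).trans (add_le_add ?_ le_rfl)
  rw [Real.norm_eq_abs, abs_le]; exact hy

/-- The weights y + 1 and y - 1 differ by 2, so D₁⁻¹ is a constant minus a tail integral. An atom at
x belongs to the closed tail `Ici x`, as in the definition. -/
lemma D1inv_eq {r : Measure ℝ} (hr : r (Icc (-1) 1)ᶜ = 0) {ψ : ℝ → ℂ} (hψ : Integrable ψ r) (x : ℝ) :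
    D1inv r ψ x = (1 / 2 : ℝ) • ∫ y, (y + 1) • ψ y ∂r - ∫ y in Ici x, ψ y ∂r := by
  have h1 : (Ico (-1) x : Set ℝ) =ᵐ[r] Iio x := by
    filter_upwards [ae_mem_Icc hr] with y hy
    exact propext ⟨fun h => h.2, fun h => ⟨hy.1, h⟩⟩
  have h2 : (Icc x 1 : Set ℝ) =ᵐ[r] Ici x := by
    filter_upwards [ae_mem_Icc hr] with y hy
    exact propext ⟨fun h => h.1, fun h => ⟨h, hy.2⟩⟩
  have hw := integrable_weight hr hψ 1
  have h3 := integral_add_compl (measurableSet_Iio (a := x)) hw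
  rw [compl_Iio] at h3
  have h4 : ∫ y in Ici x, (y - 1) • ψ y ∂r
      = ∫ y in Ici x, (y + 1) • ψ y ∂r - (2 : ℝ) • ∫ y in Ici x, ψ y ∂r := by
    rw [← integral_smul, ← integral_sub hw.integrableOn (by exact hψ.integrableOn.smul (2 : ℝ))]
    refine integral_congr_ae (Eventually.of_forall fun y => ?_)
    simp only [← sub_smul]
    congr 1; ring
  rw [D1inv, setIntegral_congr_set h1, setIntegral_congr_set h2, h4, ← h3, smul_add, smul_sub,
    smul_smul]
  norm_num
  ring

lemma integrable_coe_apply (g : Hil) (i : Fin 2) : Integrable (fun y => g y i) leb :=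
  (EuclideanSpace.proj (𝕜 := ℂ) i).integrable_comp (integrable_coe g)

lemma integral_apply {μ : Measure ℝ} {F : ℝ → Vec} (hF : Integrable F μ) (i : Fin 2) :
    (∫ y, F y ∂μ) i = ∫ y, F y i ∂μ :=
  ((EuclideanSpace.proj (𝕜 := ℂ) i).integral_comp_comm hF).symm

/-- Since g - mean g has integral zero, its two half integrals agree up to sign and add up to the
primitive that vanishes at both end points. -/
lemma D0inv_eq (g : Hil) {x : ℝ} (hx : x ∈ Icc (-1 : ℝ) 1) :
    D0inv g x = ∫ y in Iic x, g y ∂leb - ((x + 1) / 2) • ∫ y, g y ∂leb := by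
  have h1 : (Ico (-1) x : Set ℝ) =ᵐ[leb] Iic x := by
    filter_upwards [ae_mem_Icc leb_compl, compl_mem_ae_iff.2 (measure_singleton (μ := leb) x)]
      with y hy hyx
    exact propext ⟨fun h => h.2.le, fun h => ⟨hy.1, lt_of_le_of_ne h hyx⟩⟩
  have h2 : (Icc x 1 : Set ℝ) =ᵐ[leb] Ioi x := by
    filter_upwards [ae_mem_Icc leb_compl, compl_mem_ae_iff.2 (measure_singleton (μ := leb) x)]
      with y hy hyx
    exact propext ⟨fun h => lt_of_le_of_ne h.1 (Ne.symm hyx), fun h => ⟨le_of_lt h, hy.2⟩⟩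
  have hint := integrable_sub_mean g
  have h3 := integral_add_compl (measurableSet_Iic (a := x)) hint
  rw [compl_Iic] at h3
  have h0 : ∫ y, (g y - mean g) ∂leb = 0 := by
    rw [integral_sub (integrable_coe g) (integrable_const _), integral_const, leb_real_univ, mean,
      smul_smul]
    norm_num
  rw [h0] at h3
  have h4 : ∫ y in Iic x, (g y - mean g) ∂leb
      = ∫ y in Iic x, g y ∂leb - ((x + 1) / 2) • ∫ y, g y ∂leb := by
    rw [integral_sub (integrable_coe g).integrableOn (integrable_const _), integral_const,
      measureReal_restrict_apply_univ, leb_real_Iic hx, mean, smul_smul]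
    congr 2; ring
  rw [D0inv, setIntegral_congr_set h1, setIntegral_congr_set h2, ← h4,
    eq_neg_of_add_eq_zero_right h3, smul_neg, sub_neg_eq_add, ← add_smul]
  norm_num

lemma D0inv_apply_eq (g : Hil) (i : Fin 2) {x : ℝ} (hx : x ∈ Icc (-1 : ℝ) 1) :
    D0inv g x i = ∫ y in Iic x, g y i ∂leb - ((x + 1) / 2 : ℝ) * ∫ y, g y i ∂leb := by
  rw [D0inv_eq g hx, PiLp.sub_apply, PiLp.smul_apply, integral_apply (integrable_coe g).integrableOn,
    integral_apply (integrable_coe g), Complex.real_smul]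

variable {r : Measure ℝ} [IsFiniteMeasure r]

/-- Adjointness D₁⁻¹ = -(D₀⁻¹)*, by Fubini on the triangle x ≤ y. Different choices of h give the
zero mean of D₁⁻¹ (h = 1), its distributional derivative (h = η'), the energy form (h = conj g) and
the Volterra representation (h an indicator). -/
lemma integral_D1inv_mul (hr : r (Icc (-1) 1)ᶜ = 0) {ψ h : ℝ → ℂ}
    (hψ : Integrable ψ r) (hh : Integrable h leb) :
    ∫ x, D1inv r ψ x * h x ∂leb
      = -∫ y, ψ y * (∫ x in Iic y, h x ∂leb - ((y + 1) / 2 : ℝ) * ∫ x, h x ∂leb) ∂r := by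
  have hw := integrable_weight hr hψ 1
  have h1 : ∫ x, D1inv r ψ x * h x ∂leb
      = ∫ x, (((1 / 2 : ℝ) • ∫ y, (y + 1) • ψ y ∂r) * h x - (∫ y in Ici x, ψ y ∂r) * h x) ∂leb := by
    refine integral_congr_ae (Eventually.of_forall fun x => ?_)
    simp only
    rw [D1inv_eq hr hψ x, sub_mul]
  have hS : StronglyMeasurable fun x => ∫ y in Ici x, ψ y ∂r :=
    stronglyMeasurable_setIntegral r (fun x => Ici x)
      (measurableSet_le measurable_fst measurable_snd) _ hψ.aestronglyMeasurable
  have hI : Integrable (fun x => (∫ y in Ici x, ψ y ∂r) * h x) leb :=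
    hh.bdd_mul (c := ∫ y, ‖ψ y‖ ∂r) hS.aestronglyMeasurable (Eventually.of_forall fun x =>
      (norm_integral_le_integral_norm _).trans
        (setIntegral_le_integral hψ.norm (Eventually.of_forall fun _ => norm_nonneg _)))
  have hL : StronglyMeasurable fun y => ∫ x in Iic y, h x ∂leb :=
    stronglyMeasurable_setIntegral leb (fun x => Iic x)
      (measurableSet_le measurable_snd measurable_fst) _ hh.aestronglyMeasurable
  have hI2 : Integrable (fun y => ψ y * ∫ x in Iic y, h x ∂leb) r :=
    hψ.mul_bdd (c := ∫ x, ‖h x‖ ∂leb) hL.aestronglyMeasurable (Eventually.of_forall fun x =>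
      (norm_integral_le_integral_norm _).trans
        (setIntegral_le_integral hh.norm (Eventually.of_forall fun _ => norm_nonneg _)))
  rw [h1, integral_sub (hh.const_mul _) hI, integral_integral_Ici_mul r leb hψ hh,
    integral_const_mul, ← neg_sub, neg_inj]
  have h2 : ∀ y, ψ y * (∫ x in Iic y, h x ∂leb - ((y + 1) / 2 : ℝ) * ∫ x, h x ∂leb)
      = ψ y * ∫ x in Iic y, h x ∂leb - ((y + 1) • ψ y) * ((1 / 2 : ℝ) * ∫ x, h x ∂leb) := fun y => by
    rw [Complex.real_smul]; push_cast; ring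
  simp only [h2]
  rw [integral_sub hI2 (hw.mul_const _), integral_mul_const, Complex.real_smul]
  ring

lemma integral_D1inv_mul_conj (hr : r (Icc (-1) 1)ᶜ = 0) {ψ : ℝ → ℂ}
    (hψ : Integrable ψ r) (g : Hil) (i : Fin 2) :
    ∫ x, D1inv r ψ x * conj (g x i) ∂leb = -∫ y, ψ y * conj (D0inv g y i) ∂r := by
  have hg : Integrable (fun y => conj (g y i)) leb := by
    have := Complex.conjCLE.toContinuousLinearMap.integrable_comp (integrable_coe_apply g i)
    exact this
  rw [integral_D1inv_mul hr hψ hg, neg_inj]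
  refine integral_congr_ae ?_
  filter_upwards [ae_mem_Icc hr] with y hy
  rw [D0inv_apply_eq g i hy, map_sub, map_mul, Complex.conj_ofReal, ← integral_conj, ← integral_conj]

lemma integral_D1inv (hr : r (Icc (-1) 1)ᶜ = 0) {ψ : ℝ → ℂ} (hψ : Integrable ψ r) :
    ∫ x, D1inv r ψ x ∂leb = 0 := by
  have h := integral_D1inv_mul hr hψ (integrable_const (1 : ℂ))
  simp only [mul_one] at h
  rw [h, neg_eq_zero, ← integral_zero ℝ ℂ (μ := r)]
  refine integral_congr_ae ?_
  filter_upwards [ae_mem_Icc hr] with y hy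
  rw [integral_const, integral_const, measureReal_restrict_apply_univ, leb_real_Iic hy,
    leb_real_univ]
  simp

lemma IsTest.eq_zero {η : ℝ → ℝ} (hη : IsTest η) {x : ℝ} (hx : x ∉ Ioo (-1 : ℝ) 1) : η x = 0 :=
  image_eq_zero_of_notMem_tsupport fun h => hx (hη.supp h)

lemma IsTest.deriv {η : ℝ → ℝ} (hη : IsTest η) : IsTest (deriv η) where
  smooth := (contDiff_infty_iff_deriv.1 hη.smooth).2
  compact := hη.compact.deriv
  supp := tsupport_deriv_subset.trans hη.supp

lemma IsTest.continuous {η : ℝ → ℝ} (hη : IsTest η) : Continuous η := hη.smooth.continuous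

lemma IsTest.integrable {η : ℝ → ℝ} (hη : IsTest η) (μ : Measure ℝ) [IsFiniteMeasure μ] :
    Integrable (fun x => (η x : ℂ)) μ :=
  (hη.continuous.integrable_of_hasCompactSupport hη.compact).ofReal

lemma integral_Iic_leb {h : ℝ → ℂ} {y : ℝ} (hy : y ∈ Icc (-1 : ℝ) 1) :
    ∫ x in Iic y, h x ∂leb = ∫ x in (-1)..y, h x := by
  have h1 : Iic y ∩ Icc (-1) 1 = Icc (-1) y := by
    ext z; simp only [mem_inter_iff, mem_Iic, mem_Icc]
    constructor
    · rintro ⟨h1, h2, -⟩; exact ⟨h2, h1⟩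
    · rintro ⟨h1, h2⟩; exact ⟨h2, h1, h2.trans hy.2⟩
  rw [leb, Measure.restrict_restrict measurableSet_Iic, h1, integral_Icc_eq_integral_Ioc,
    intervalIntegral.integral_of_le hy.1]

lemma integral_leb {h : ℝ → ℂ} : ∫ x, h x ∂leb = ∫ x in (-1)..1, h x := by
  rw [leb, integral_Icc_eq_integral_Ioc, intervalIntegral.integral_of_le (by norm_num)]

lemma IsTest.integral_deriv_Iic {η : ℝ → ℝ} (hη : IsTest η) {y : ℝ} (hy : y ∈ Icc (-1 : ℝ) 1) :
    ∫ x in Iic y, ((_root_.deriv η x : ℝ) : ℂ) ∂leb = η y := by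
  rw [integral_Iic_leb hy, intervalIntegral.integral_ofReal, intervalIntegral.integral_deriv_eq_sub
    (fun x _ => (hη.smooth.differentiable (by simp)) x)
    (hη.deriv.continuous.intervalIntegrable _ _), hη.eq_zero (x := -1) (by simp), sub_zero]

lemma IsTest.integral_deriv {η : ℝ → ℝ} (hη : IsTest η) :
    ∫ x, ((_root_.deriv η x : ℝ) : ℂ) ∂leb = 0 := by
  have h := hη.integral_deriv_Iic (y := 1) (by simp)
  rw [hη.eq_zero (x := 1) (by simp), integral_Iic_leb (by simp)] at h
  rw [integral_leb, h]; simp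

lemma integral_D1inv_mul_deriv (hr : r (Icc (-1) 1)ᶜ = 0) {ψ : ℝ → ℂ}
    (hψ : Integrable ψ r) {η : ℝ → ℝ} (hη : IsTest η) :
    ∫ x, D1inv r ψ x * ((deriv η x : ℝ) : ℂ) ∂leb = -∫ y, ψ y * (η y : ℂ) ∂r := by
  rw [integral_D1inv_mul hr hψ (hη.deriv.integrable leb), neg_inj, hη.integral_deriv]
  refine integral_congr_ae ?_
  filter_upwards [ae_mem_Icc hr] with y hy
  rw [hη.integral_deriv_Iic hy, mul_zero, sub_zero]

lemma mean_apply (g : Hil) (i : Fin 2) : mean g i = (1 / 2 : ℝ) * ∫ y, g y i ∂leb := by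
  rw [mean, PiLp.smul_apply, integral_apply (integrable_coe g), Complex.real_smul]

lemma D0inv_left (g : Hil) : D0inv g (-1) = 0 := by
  rw [D0inv_eq g (by simp)]
  have : leb.restrict (Iic (-1)) = 0 := by
    rw [Measure.restrict_eq_zero, leb, Measure.restrict_apply measurableSet_Iic]
    refine measure_mono_null (t := {(-1 : ℝ)}) (fun x hx => ?_) (by simp)
    exact le_antisymm hx.1 hx.2.1
  rw [this]; simp

lemma D0inv_right (g : Hil) : D0inv g 1 = 0 := by
  rw [D0inv_eq g (by simp)]
  have : leb.restrict (Iic 1) = leb := by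
    refine Measure.restrict_eq_self_of_ae_mem ?_
    filter_upwards [ae_mem_Icc leb_compl] with x hx using hx.2
  rw [this]; norm_num

lemma continuousOn_D0inv_apply (g : Hil) (i : Fin 2) :
    ContinuousOn (fun x => D0inv g x i) (Icc (-1) 1) := by
  have h1 : ContinuousOn (fun x => (∫ y in (-1)..x, g y i)
      - ((x + 1) / 2 : ℝ) * ∫ y, g y i ∂leb) (Icc (-1) 1) := by
    refine ContinuousOn.sub ?_ (Continuous.continuousOn (by fun_prop))
    have h2 : IntegrableOn (fun y => g y i) (uIcc (-1) 1) volume := by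
      rw [uIcc_of_le (by norm_num)]; exact integrable_coe_apply g i
    have := intervalIntegral.continuousOn_primitive_interval h2
    rwa [uIcc_of_le (by norm_num)] at this
  refine h1.congr fun x hx => ?_
  simp only
  rw [D0inv_apply_eq g i hx, integral_Iic_leb hx]

lemma continuousOn_D0inv (g : Hil) : ContinuousOn (D0inv g) (Icc (-1) 1) := by
  have h : ContinuousOn (fun x => (fun i => D0inv g x i : Fin 2 → ℂ)) (Icc (-1) 1) :=
    continuousOn_pi.2 fun i => continuousOn_D0inv_apply g i
  exact (PiLp.continuous_toLp 2 _).comp_continuousOn h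

/-- `D₀⁻¹ g` is a primitive of `g - mean g`. -/
lemma integral_D0inv_mul_deriv (g : Hil) (i : Fin 2) {η : ℝ → ℝ} (hη : IsTest η) :
    ∫ x, D0inv g x i * ((deriv η x : ℝ) : ℂ) ∂leb = -∫ y, (g y i - mean g i) * (η y : ℂ) ∂leb := by
  have hψ : Integrable (fun y => g y i - mean g i) leb :=
    (integrable_coe_apply g i).sub (integrable_const _)
  have h0 : ∫ y, (g y i - mean g i) ∂leb = 0 := by
    rw [integral_sub (integrable_coe_apply g i) (integrable_const _), integral_const,
      leb_real_univ, mean_apply]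
    simp
  -- Written as a tail integral, the primitive falls under the same interchange of integrals as
  -- D₁⁻¹.
  have h1 : ∀ x ∈ Icc (-1 : ℝ) 1, D0inv g x i = -∫ y in Ici x, (g y i - mean g i) ∂leb := by
    intro x hx
    have h3 := integral_add_compl (measurableSet_Iic (a := x)) hψ
    rw [compl_Iic, h0, ← integral_Ici_eq_integral_Ioi] at h3
    rw [← eq_neg_of_add_eq_zero_left h3, D0inv_apply_eq g i hx,
      integral_sub (integrable_coe_apply g i).integrableOn (integrable_const _), integral_const,
      measureReal_restrict_apply_univ, leb_real_Iic hx, mean_apply, Complex.real_smul]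
    push_cast; ring
  have h2 : ∫ x, D0inv g x i * ((deriv η x : ℝ) : ℂ) ∂leb
      = -∫ x, (∫ y in Ici x, (g y i - mean g i) ∂leb) * ((deriv η x : ℝ) : ℂ) ∂leb := by
    rw [← integral_neg]
    refine integral_congr_ae ?_
    filter_upwards [ae_mem_Icc leb_compl] with x hx
    rw [h1 x hx, neg_mul]
  rw [h2, integral_integral_Ici_mul leb leb hψ (hη.deriv.integrable leb), neg_inj]
  refine integral_congr_ae ?_
  filter_upwards [ae_mem_Icc leb_compl] with y hy
  rw [hη.integral_deriv_Iic hy]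

end Integration

/-! ### Functions with vanishing first or second distributional derivative. -/

section Distributions

lemma IsTest.sub {η ζ : ℝ → ℝ} (hη : IsTest η) (hζ : IsTest ζ) : IsTest (η - ζ) where
  smooth := hη.smooth.sub hζ.smooth
  compact := hη.compact.sub hζ.compact
  supp := (tsupport_sub η ζ).trans (union_subset hη.supp hζ.supp)

lemma IsTest.const_mul {η : ℝ → ℝ} (hη : IsTest η) (c : ℝ) : IsTest fun x => c * η x where
  smooth := contDiff_const.mul hη.smooth
  compact := hη.compact.mul_left
  supp := (tsupport_mul_subset_right (f := fun _ => c)).trans hη.supp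

lemma IsTest.id_mul {η : ℝ → ℝ} (hη : IsTest η) : IsTest fun x => x * η x where
  smooth := contDiff_id.mul hη.smooth
  compact := hη.compact.mul_left
  supp := (tsupport_mul_subset_right (f := fun x : ℝ => x)).trans hη.supp

lemma IsTest.integral_id_mul_deriv {η : ℝ → ℝ} (hη : IsTest η) :
    ∫ x, (x : ℂ) * ((_root_.deriv η x : ℝ) : ℂ) ∂leb = -∫ x, (η x : ℂ) ∂leb := by
  have h := hη.id_mul.integral_deriv
  have hd : ∀ x, _root_.deriv (fun x => x * η x) x = η x + x * _root_.deriv η x := fun x => by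
    have := (hasDerivAt_id' x).fun_mul ((hη.smooth.differentiable (by simp)) x).hasDerivAt
    simpa using this.deriv
  simp only [hd, Complex.ofReal_add, Complex.ofReal_mul] at h
  have hi : Integrable (fun x : ℝ => (x : ℂ) * ((_root_.deriv η x : ℝ) : ℂ)) leb := by
    simpa using hη.deriv.id_mul.integrable leb
  rw [integral_add (hη.integrable leb) hi] at h
  exact eq_neg_of_add_eq_zero_right h

lemma exists_test_integral_one : ∃ χ : ℝ → ℝ, IsTest χ ∧ ∫ x, χ x ∂leb = 1 := by
  let b : ContDiffBump (0 : ℝ) := ⟨1 / 4, 1 / 2, by norm_num, by norm_num⟩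
  have hs : tsupport (b.normed volume) ⊆ Ioo (-1) 1 := by
    rw [b.tsupport_normed_eq]
    intro x hx
    rw [Metric.mem_closedBall, Real.dist_eq, sub_zero, abs_le] at hx
    have h : b.rOut = 1 / 2 := rfl
    rw [h] at hx
    constructor <;> linarith [hx.1, hx.2]
  refine ⟨b.normed volume, ⟨b.contDiff_normed, b.hasCompactSupport_normed, hs⟩, ?_⟩
  rw [leb, setIntegral_eq_integral_of_forall_compl_eq_zero, b.integral_normed]
  intro x hx
  exact image_eq_zero_of_notMem_tsupport fun h => hx (Ioo_subset_Icc_self (hs h))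

/-- A test function of integral zero has a primitive that is a test function. -/
lemma IsTest.exists_primitive {ζ : ℝ → ℝ} (hζ : IsTest ζ) (h0 : ∫ x, ζ x ∂leb = 0) :
    ∃ η, IsTest η ∧ _root_.deriv η = ζ := by
  let η : ℝ → ℝ := fun x => ∫ y in (-1)..x, ζ y
  have hder : ∀ x, HasDerivAt η (ζ x) x := fun x =>
    intervalIntegral.integral_hasDerivAt_right (hζ.continuous.intervalIntegrable _ _)
      (hζ.continuous.stronglyMeasurableAtFilter _ _) hζ.continuous.continuousAt
  have hd : _root_.deriv η = ζ := funext fun x => (hder x).deriv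
  have hone : ∫ y in (-1)..1, ζ y = 0 := by
    rw [← h0, leb, integral_Icc_eq_integral_Ioc, intervalIntegral.integral_of_le (by norm_num)]
  -- The compact support of ζ stays away from ±1. The primitive vanishes to the left of it
  -- trivially, and to the right of it because ζ has integral zero.
  obtain ⟨a, ha, hleft⟩ : ∃ a : ℝ, -1 < a ∧ ∀ x ≤ a, ζ x = 0 := by
    rcases (tsupport ζ).eq_empty_or_nonempty with he | hne
    · exact ⟨0, by norm_num, fun x _ => image_eq_zero_of_notMem_tsupport (by simp [he])⟩
    · obtain ⟨b, hb, hle⟩ := hζ.compact.isCompact.exists_isLeast hne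
      have h1 := (hζ.supp hb).1
      refine ⟨(b - 1) / 2, by linarith, fun x hx => image_eq_zero_of_notMem_tsupport fun h => ?_⟩
      linarith [hle h]
  obtain ⟨b, hb, hright⟩ : ∃ b : ℝ, b < 1 ∧ ∀ x ≥ b, ζ x = 0 := by
    rcases (tsupport ζ).eq_empty_or_nonempty with he | hne
    · exact ⟨0, by norm_num, fun x _ => image_eq_zero_of_notMem_tsupport (by simp [he])⟩
    · obtain ⟨b, hb, hle⟩ := hζ.compact.isCompact.exists_isGreatest hne
      have h1 := (hζ.supp hb).2
      refine ⟨(b + 1) / 2, by linarith, fun x hx => image_eq_zero_of_notMem_tsupport fun h => ?_⟩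
      linarith [hle h]
  have hsub : Function.support η ⊆ Icc a b := by
    intro x hx
    by_contra hxab
    apply hx
    rcases not_and_or.1 hxab with h | h
    · refine (intervalIntegral.integral_congr fun y hy => ?_).trans intervalIntegral.integral_zero
      refine hleft y ?_
      rcases mem_uIcc.1 hy with h' | h' <;> linarith [h'.1, h'.2]
    · have h2 : ∫ y in (1:ℝ)..x, ζ y = 0 := by
        refine (intervalIntegral.integral_congr fun y hy => ?_).trans intervalIntegral.integral_zero
        refine hright y ?_
        rcases mem_uIcc.1 hy with h' | h' <;> linarith [h'.1, h'.2]
      have h3 := intervalIntegral.integral_add_adjacent_intervals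
        (hζ.continuous.intervalIntegrable (μ := volume) (-1) 1)
        (hζ.continuous.intervalIntegrable 1 x)
      rw [hone, h2, add_zero] at h3
      exact h3.symm
  have hts : tsupport η ⊆ Icc a b := closure_minimal hsub isClosed_Icc
  refine ⟨η, ⟨?_, ?_, ?_⟩, hd⟩
  · rw [contDiff_infty_iff_deriv, hd]
    exact ⟨fun x => (hder x).differentiableAt, hζ.smooth⟩
  · exact HasCompactSupport.of_support_subset_isCompact isCompact_Icc hsub
  · exact hts.trans fun x hx => ⟨ha.trans_le hx.1, hx.2.trans_lt hb⟩

lemma ae_eq_zero_of_test {w : ℝ → ℂ} (hw : Integrable w leb)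
    (h : ∀ η, IsTest η → ∫ x, w x * (η x : ℂ) ∂leb = 0) : w =ᵐ[leb] 0 := by
  have hU : LocallyIntegrableOn w (Ioo (-1) 1) volume :=
    (IntegrableOn.mono_set (t := Icc (-1 : ℝ) 1) hw Ioo_subset_Icc_self).locallyIntegrableOn
  have h1 := isOpen_Ioo.ae_eq_zero_of_integral_contDiff_smul_eq_zero hU fun η h1 h2 h3 => by
    have hη : IsTest η := ⟨h1, h2, h3⟩
    rw [← h η hη, leb, setIntegral_eq_integral_of_forall_compl_eq_zero]
    · exact integral_congr_ae (Eventually.of_forall fun x => by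
        simp only [Complex.real_smul, mul_comm])
    · intro x hx
      rw [hη.eq_zero fun h' => hx (Ioo_subset_Icc_self h')]; simp
  filter_upwards [ae_restrict_of_ae h1, ae_mem_Icc leb_compl,
    compl_mem_ae_iff.2 (measure_singleton (μ := leb) 1),
    compl_mem_ae_iff.2 (measure_singleton (μ := leb) (-1))] with x h2 h3 h4 h5
  exact h2 ⟨lt_of_le_of_ne h3.1 (Ne.symm h5), lt_of_le_of_ne h3.2 h4⟩

lemma integrable_mul_test {w : ℝ → ℂ} {r : Measure ℝ} (hw : Integrable w r) {η : ℝ → ℝ}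
    (hη : IsTest η) : Integrable (fun x => w x * (η x : ℂ)) r := by
  obtain ⟨B, hB⟩ := hη.compact.exists_bound_of_continuous hη.continuous
  have hc := hη.continuous
  refine hw.mul_bdd (c := B) (Complex.continuous_ofReal.comp hc).aestronglyMeasurable
    (Eventually.of_forall fun x => ?_)
  simpa using hB x

/-- Integrating against the derivatives of test functions, up to a fixed correction. -/
lemma exists_test_deriv_eq {χ : ℝ → ℝ} (hχ : IsTest χ) (h1 : ∫ x, χ x ∂leb = 1) {ζ : ℝ → ℝ}
    (hζ : IsTest ζ) : ∃ η, IsTest η ∧ deriv η = ζ - fun x => (∫ x, ζ x ∂leb) * χ x := by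
  refine (hζ.sub (hχ.const_mul (∫ x, ζ x ∂leb))).exists_primitive ?_
  have hi : ∀ {η : ℝ → ℝ}, IsTest η → Integrable η leb := fun h =>
    h.continuous.integrable_of_hasCompactSupport h.compact
  simp only [Pi.sub_apply]
  rw [integral_sub (hi hζ) ((hi hχ).const_mul _), integral_const_mul, h1]
  ring

/-- Du Bois-Reymond: for a fixed test function χ of integral one, ζ - (∫ ζ) χ is the derivative of a
test function, so ∫ w ζ = (∫ w χ) ∫ ζ for every test function ζ. -/
lemma ae_eq_const_of_integral_deriv {w : ℝ → ℂ} (hw : Integrable w leb)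
    (h : ∀ η, IsTest η → ∫ x, w x * ((deriv η x : ℝ) : ℂ) ∂leb = 0) :
    ∃ c : ℂ, ∀ᵐ x ∂leb, w x = c := by
  obtain ⟨χ, hχ, hχ1⟩ := exists_test_integral_one
  refine ⟨∫ x, w x * (χ x : ℂ) ∂leb, ?_⟩
  set d := ∫ x, w x * (χ x : ℂ) ∂leb with hd
  have h1 := ae_eq_zero_of_test (hw.sub (integrable_const d)) fun ζ hζ => by
    obtain ⟨η, hη, hηd⟩ := exists_test_deriv_eq hχ hχ1 hζ
    have h2 := h η hη
    have h3 : ∀ x, w x * ((deriv η x : ℝ) : ℂ)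
        = w x * (ζ x : ℂ) - ((∫ x, ζ x ∂leb : ℝ) : ℂ) * (w x * (χ x : ℂ)) := fun x => by
      rw [hηd]; simp only [Pi.sub_apply]; push_cast; ring
    simp only [h3] at h2
    rw [integral_sub (integrable_mul_test hw hζ) ((integrable_mul_test hw hχ).const_mul _),
      integral_const_mul, ← hd] at h2
    have h4 : ∀ x, (w x - d) * (ζ x : ℂ) = w x * (ζ x : ℂ) - d * (ζ x : ℂ) := fun x => by ring
    simp only [Pi.sub_apply, h4]
    rw [integral_sub (integrable_mul_test hw hζ) ((hζ.integrable leb).const_mul _),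
      integral_const_mul, integral_complex_ofReal, mul_comm d, h2]
  filter_upwards [h1] with x hx
  exact sub_eq_zero.1 hx

/-- A continuous function with second distributional derivative zero that vanishes at the end
points is zero. -/
lemma eqOn_zero_of_integral_deriv_deriv {w : ℝ → ℂ} (hc : ContinuousOn w (Icc (-1) 1))
    (hl : w (-1) = 0) (hr : w 1 = 0)
    (h : ∀ η, IsTest η → ∫ x, w x * ((deriv (deriv η) x : ℝ) : ℂ) ∂leb = 0) :
    ∀ x ∈ Icc (-1 : ℝ) 1, w x = 0 := by
  have hw : Integrable w leb := hc.integrableOn_Icc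
  obtain ⟨χ, hχ, hχ1⟩ := exists_test_integral_one
  -- The hypothesis gives ∫ w ζ' = c ∫ ζ, so w has derivative -c, and w + c x has derivative zero.
  set c := ∫ x, w x * ((deriv χ x : ℝ) : ℂ) ∂leb with hcdef
  have hx : Integrable (fun x : ℝ => c * (x : ℂ)) leb :=
    (Continuous.continuousOn (by fun_prop)).integrableOn_Icc
  obtain ⟨d, hd⟩ := ae_eq_const_of_integral_deriv (w := fun x => w x + c * x) (hw.add hx)
    fun ζ hζ => by
      obtain ⟨η, hη, hηd⟩ := exists_test_deriv_eq hχ hχ1 hζ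
      have h2 := h η hη
      have h3 : ∀ x, w x * ((deriv (deriv η) x : ℝ) : ℂ) = w x * ((deriv ζ x : ℝ) : ℂ)
          - ((∫ x, ζ x ∂leb : ℝ) : ℂ) * (w x * ((deriv χ x : ℝ) : ℂ)) := fun x => by
        have h5 : deriv (deriv η) x = deriv ζ x - (∫ x, ζ x ∂leb) * deriv χ x := by
          rw [hηd]
          have h6 := (((hζ.smooth.differentiable (by simp)) x).hasDerivAt.sub
            (((hχ.smooth.differentiable (by simp)) x).hasDerivAt.const_mul (∫ x, ζ x ∂leb)))
          exact h6.deriv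
        rw [h5]; push_cast; ring
      simp only [h3] at h2
      rw [integral_sub (integrable_mul_test hw hζ.deriv)
        ((integrable_mul_test hw hχ.deriv).const_mul _), integral_const_mul, ← hcdef] at h2
      have h4 : ∀ x : ℝ, (w x + c * x) * ((deriv ζ x : ℝ) : ℂ)
        = w x * ((deriv ζ x : ℝ) : ℂ) + c * ((x : ℂ) * ((deriv ζ x : ℝ) : ℂ)) := fun x => by ring
      have hi : Integrable (fun x : ℝ => (x : ℂ) * ((deriv ζ x : ℝ) : ℂ)) leb := by
        simpa using hζ.deriv.id_mul.integrable leb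
      simp only [h4]
      rw [integral_add (integrable_mul_test hw hζ.deriv) (hi.const_mul _), integral_const_mul,
        hζ.integral_id_mul_deriv, integral_complex_ofReal]
      linear_combination h2
  have heq : EqOn (fun x => w x + c * (x : ℂ)) (fun _ => d) (Icc (-1) 1) :=
    Measure.eqOn_Icc_of_ae_eq volume (by norm_num) hd
      (hc.add (Continuous.continuousOn (by fun_prop))) continuousOn_const
  have h1 := heq (x := 1) (by simp)
  have h2 := heq (x := -1) (by simp)
  simp only [hl, hr] at h1 h2
  push_cast at h1 h2
  have hc0 : c = 0 := by linear_combination (h1 - h2) / 2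
  have hd0 : d = 0 := by linear_combination -(h1 + h2) / 2
  intro x hx
  have h3 := heq hx
  simpa [hc0, hd0] using h3

end Distributions

/-! ### Dirichlet eigenfunctions as eigenvectors of `T`. -/

section Eigenfunctions

variable {r : Measure ℝ}

lemma integrable_of_continuousOn [IsFiniteMeasure r] (hr : r (Icc (-1) 1)ᶜ = 0) {ψ : ℝ → ℂ}
    (hψ : ContinuousOn ψ (Icc (-1) 1)) : Integrable ψ r := by
  have h : IntegrableOn ψ (Icc (-1) 1) r := hψ.integrableOn_Icc
  rwa [IntegrableOn, Measure.restrict_eq_self_of_ae_mem (ae_mem_Icc hr)] at h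

lemma D1inv_congr (hr : r (Icc (-1) 1)ᶜ = 0) {ψ ψ' : ℝ → ℂ} (h : EqOn ψ ψ' (Icc (-1) 1)) :
    D1inv r ψ = D1inv r ψ' := by
  have h1 : ∀ᵐ x ∂r, ψ x = ψ' x := (ae_mem_Icc hr).mono fun x hx => h hx
  funext x
  unfold D1inv
  congr 2 <;>
  exact integral_congr_ae (ae_restrict_of_ae (h1.mono fun y hy => by simp only [hy]))

lemma memLp_D1inv [IsFiniteMeasure r] (hr : r (Icc (-1) 1)ᶜ = 0) {ψ : ℝ → ℂ} (hψ : Integrable ψ r) :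
    MemLp (D1inv r ψ) 2 leb := by
  have hS : StronglyMeasurable fun x => ∫ y in Ici x, ψ y ∂r :=
    stronglyMeasurable_setIntegral r (fun x => Ici x)
      (measurableSet_le measurable_fst measurable_snd) _ hψ.aestronglyMeasurable
  have h : MemLp (fun x => ∫ y in Ici x, ψ y ∂r) 2 leb :=
    MemLp.of_bound hS.aestronglyMeasurable (∫ y, ‖ψ y‖ ∂r) (Eventually.of_forall fun x =>
      (norm_integral_le_integral_norm _).trans
        (setIntegral_le_integral hψ.norm (Eventually.of_forall fun _ => norm_nonneg _)))
  have h' := (memLp_const ((1 / 2 : ℝ) • ∫ y, (y + 1) • ψ y ∂r) (μ := leb) (p := 2)).sub h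
  convert h' using 1
  exact funext fun x => D1inv_eq hr hψ x

lemma D0inv_zero (x : ℝ) : D0inv 0 x = 0 := by
  simpa using D0inv_smul 0 0 x

lemma ext_apply {f g : Hil} (h : ∀ i, ∀ᵐ x ∂leb, f x i = g x i) : f = g := by
  refine Lp.ext ?_
  filter_upwards [h 0, h 1] with x h0 h1
  ext i
  fin_cases i
  · exact h0
  · exact h1

variable {m n : Measure ℝ} [IsFiniteMeasure m] [IsFiniteMeasure n]

lemma T_ae (f : Hil) : ∀ᵐ x ∂leb, T m n f x = Tfun m n f x := (memLp_Tfun m n f).coeFn_toLp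

lemma T_apply_zero (f : Hil) : ∀ᵐ x ∂leb, T m n f x 0 = D1inv n (fun y => D0inv f y 1) x := by
  filter_upwards [T_ae (m := m) (n := n) f] with x hx
  rw [hx]; rfl

lemma T_apply_one (f : Hil) : ∀ᵐ x ∂leb, T m n f x 1 = D1inv m (fun y => D0inv f y 0) x := by
  filter_upwards [T_ae (m := m) (n := n) f] with x hx
  rw [hx]; rfl

lemma integrable_D0inv [IsFiniteMeasure r] (hr : r (Icc (-1) 1)ᶜ = 0) (f : Hil) (i : Fin 2) :
    Integrable (fun y => D0inv f y i) r :=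
  integrable_of_continuousOn hr (continuousOn_D0inv_apply f i)

variable (hm : m (Icc (-1) 1)ᶜ = 0) (hn : n (Icc (-1) 1)ᶜ = 0)

include hm hn

lemma mean_T (f : Hil) : mean (T m n f) = 0 := by
  have h0 := integral_D1inv hn (integrable_D0inv hn f 1)
  have h1 := integral_D1inv hm (integrable_D0inv hm f 0)
  rw [← integral_congr_ae (T_apply_zero (m := m) (n := n) f)] at h0
  rw [← integral_congr_ae (T_apply_one (m := m) (n := n) f)] at h1
  ext i
  fin_cases i
  · simp only [Fin.zero_eta, mean_apply, h0]; simp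
  · simp only [Fin.mk_one, mean_apply, h1]; simp

lemma T_eq_zero_of_D0inv {f : Hil} (h : ∀ x ∈ Icc (-1 : ℝ) 1, D0inv f x = 0) :
    T m n f = 0 := by
  have hz : ∀ s : Measure ℝ, D1inv s (fun _ => 0) = fun _ => 0 := fun s => by
    funext x; simp [D1inv]
  refine ext_apply fun i => ?_
  fin_cases i
  · filter_upwards [T_apply_zero (m := m) (n := n) f, Lp.coeFn_zero Vec 2 leb] with x hx h0
    simp only [Fin.zero_eta]
    rw [hx, h0, D1inv_congr hn (ψ' := fun _ => 0) (fun y hy => by simp [h y hy]), hz]; rfl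
  · filter_upwards [T_apply_one (m := m) (n := n) f, Lp.coeFn_zero Vec 2 leb] with x hx h0
    simp only [Fin.mk_one]
    rw [hx, h0, D1inv_congr hm (ψ' := fun _ => 0) (fun y hy => by simp [h y hy]), hz]; rfl

/-- Eigenvectors of `T` give Dirichlet eigenvalues. -/
lemma mem_eigenvalues_of_T {l : ℂ} {f : Hil} (hf : f ≠ 0) (h : l • T m n f = f) :
    l ∈ eigenvalues m n := by
  -- The range of `T` consists of functions of mean zero, so `D0inv f` has derivative exactly f,
  -- without a correction by the mean.
  have hmean : mean f = 0 := by rw [← h, mean_smul, mean_T hm hn, smul_zero]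
  have hfa := Lp.coeFn_smul l (T m n f)
  rw [h] at hfa
  refine ⟨D0inv f, ⟨continuousOn_D0inv f, D0inv_left f, D0inv_right f, fun η hη => ?_,
    fun η hη => ?_⟩, ?_⟩
  · rw [iteratedDeriv_succ, iteratedDeriv_one, integral_D0inv_mul_deriv f 0 hη.deriv, hmean]
    have h1 : ∀ᵐ x ∂leb, (f x 0 - (0 : Vec) 0) * ((deriv η x : ℝ) : ℂ)
        = l * (D1inv n (fun y => D0inv f y 1) x * ((deriv η x : ℝ) : ℂ)) := by
      filter_upwards [hfa, T_apply_zero (m := m) (n := n) f] with x h2 h3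
      rw [h2, Pi.smul_apply, PiLp.smul_apply, h3]; simp [mul_assoc]
    rw [integral_congr_ae h1, integral_const_mul,
      integral_D1inv_mul_deriv hn (integrable_D0inv hn f 1) hη]
    ring
  · rw [iteratedDeriv_succ, iteratedDeriv_one, integral_D0inv_mul_deriv f 1 hη.deriv, hmean]
    have h1 : ∀ᵐ x ∂leb, (f x 1 - (0 : Vec) 1) * ((deriv η x : ℝ) : ℂ)
        = l * (D1inv m (fun y => D0inv f y 0) x * ((deriv η x : ℝ) : ℂ)) := by
      filter_upwards [hfa, T_apply_one (m := m) (n := n) f] with x h2 h3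
      rw [h2, Pi.smul_apply, PiLp.smul_apply, h3]; simp [mul_assoc]
    rw [integral_congr_ae h1, integral_const_mul,
      integral_D1inv_mul_deriv hm (integrable_D0inv hm f 0) hη]
    ring
  · by_contra! hcon
    exact hf (by rw [← h, T_eq_zero_of_D0inv hm hn hcon, smul_zero])

/-- A Dirichlet solution is `D₀⁻¹ g` for an eigenvector `g` of `T`. -/
lemma IsDirichletSolution.exists_eigenvector {l : ℂ} {φ : ℝ → Vec}
    (hφ : IsDirichletSolution m n l φ) :
    ∃ g : Hil, l • T m n g = g ∧ mean g = 0 ∧ EqOn φ (D0inv g) (Icc (-1) 1) := by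
  have hc : ∀ i, ContinuousOn (fun x => φ x i) (Icc (-1) 1) := fun i =>
    (EuclideanSpace.proj (𝕜 := ℂ) i).continuous.comp_continuousOn hφ.cont
  have hi0 := integrable_of_continuousOn hm (hc 0)
  have hi1 := integrable_of_continuousOn hn (hc 1)
  -- The candidate for Dφ. It is formed from φ directly, because φ = D₀⁻¹ g is not yet known and `T`
  -- cannot be used.
  let F : ℝ → Vec := fun x => l • !₂[D1inv n (fun y => φ y 1) x, D1inv m (fun y => φ y 0) x]
  have hF : MemLp F 2 leb := by
    refine MemLp.const_smul (MemLp.of_eval_piLp fun i => ?_) l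
    fin_cases i
    · exact memLp_D1inv hn hi1
    · exact memLp_D1inv hm hi0
  let g : Hil := hF.toLp F
  have hg : ∀ᵐ x ∂leb, g x = F x := hF.coeFn_toLp
  have hg0 : ∀ᵐ x ∂leb, g x 0 = l * D1inv n (fun y => φ y 1) x := hg.mono fun x hx => by
    rw [hx]; rfl
  have hg1 : ∀ᵐ x ∂leb, g x 1 = l * D1inv m (fun y => φ y 0) x := hg.mono fun x hx => by
    rw [hx]; rfl
  have hmean : mean g = 0 := by
    ext i
    fin_cases i
    · simp only [Fin.zero_eta, mean_apply]
      rw [integral_congr_ae hg0, integral_const_mul, integral_D1inv hn hi1]; simp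
    · simp only [Fin.mk_one, mean_apply]
      rw [integral_congr_ae hg1, integral_const_mul, integral_D1inv hm hi0]; simp
  -- Both functions have second derivative l M φ and vanish at ±1.
  have hw : ∀ i, ∀ x ∈ Icc (-1 : ℝ) 1, φ x i - D0inv g x i = 0 := by
    intro i
    refine eqOn_zero_of_integral_deriv_deriv ((hc i).sub (continuousOn_D0inv_apply g i))
      (by rw [hφ.left, D0inv_left, sub_self]) (by rw [hφ.right, D0inv_right, sub_self])
      fun η hη => ?_
    have h1 : ∀ x, (φ x i - D0inv g x i) * ((deriv (deriv η) x : ℝ) : ℂ)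
        = φ x i * ((deriv (deriv η) x : ℝ) : ℂ)
          - D0inv g x i * ((deriv (deriv η) x : ℝ) : ℂ) := fun x => sub_mul _ _ _
    simp only [h1]
    rw [integral_sub
        (integrable_mul_test (integrable_of_continuousOn leb_compl (hc i)) hη.deriv.deriv)
        (integrable_mul_test (integrable_D0inv leb_compl g i) hη.deriv.deriv),
      integral_D0inv_mul_deriv g i hη.deriv, hmean]
    have e0 := hφ.eq₁ η hη
    have e1 := hφ.eq₂ η hη
    rw [iteratedDeriv_succ, iteratedDeriv_one] at e0 e1
    fin_cases i
    · simp only [Fin.zero_eta]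
      have h2 : ∀ᵐ x ∂leb, (g x 0 - (0 : Vec) 0) * ((deriv η x : ℝ) : ℂ)
          = l * (D1inv n (fun y => φ y 1) x * ((deriv η x : ℝ) : ℂ)) := by
        filter_upwards [hg0] with x h2
        rw [h2]; simp [mul_assoc]
      rw [integral_congr_ae h2, integral_const_mul, integral_D1inv_mul_deriv hn hi1 hη, e0]
      ring
    · simp only [Fin.mk_one]
      have h2 : ∀ᵐ x ∂leb, (g x 1 - (0 : Vec) 1) * ((deriv η x : ℝ) : ℂ)
          = l * (D1inv m (fun y => φ y 0) x * ((deriv η x : ℝ) : ℂ)) := by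
        filter_upwards [hg1] with x h2
        rw [h2]; simp [mul_assoc]
      rw [integral_congr_ae h2, integral_const_mul, integral_D1inv_mul_deriv hm hi0 hη, e1]
      ring
  refine ⟨g, ?_, hmean, fun x hx => ?_⟩
  · have hs := Lp.coeFn_smul l (T m n g)
    refine ext_apply fun i => ?_
    fin_cases i
    · filter_upwards [hs, T_apply_zero (m := m) (n := n) g, hg0] with x h1 h2 h3
      simp only [Fin.zero_eta]
      rw [h1, Pi.smul_apply, PiLp.smul_apply, h2, h3, smul_eq_mul,
        D1inv_congr hn fun y hy => sub_eq_zero.1 (hw 1 y hy)]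
    · filter_upwards [hs, T_apply_one (m := m) (n := n) g, hg1] with x h1 h2 h3
      simp only [Fin.mk_one]
      rw [h1, Pi.smul_apply, PiLp.smul_apply, h2, h3, smul_eq_mul,
        D1inv_congr hm fun y hy => sub_eq_zero.1 (hw 0 y hy)]
  · ext i
    exact sub_eq_zero.1 (hw i x hx)

/-- The eigenfunctions are eigenvectors of `T`. -/
lemma IsEigenfunction.eigenvector {l : ℂ} {f : Hil} (hf : IsEigenfunction m n l f) :
    f ≠ 0 ∧ l • T m n f = f := by
  obtain ⟨φ, hφ, ⟨x, hx, hne⟩, hd⟩ := hf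
  obtain ⟨g, hg, hmean, heq⟩ := hφ.exists_eigenvector hm hn
  -- Both f and g are distributional derivatives of φ, so they agree almost everywhere.
  suffices hfg : f = g by
    subst hfg
    refine ⟨fun h0 => hne ?_, hg⟩
    rw [heq hx, h0, D0inv_zero]
  have hφi : Integrable φ leb := hφ.cont.integrableOn_Icc
  refine ext_apply fun i => ?_
  have h1 := ae_eq_zero_of_test ((integrable_coe_apply f i).sub (integrable_coe_apply g i))
    fun η hη => by
      have h2 := congrArg (fun v : Vec => v i) (hd η hη)
      have h3 : Integrable (fun x => η x • f x) leb := by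
        obtain ⟨B, hB⟩ := hη.compact.exists_bound_of_continuous hη.continuous
        exact (integrable_coe f).bdd_smul (φ := η) B hη.continuous.aestronglyMeasurable
          (Eventually.of_forall hB)
      have h4 : Integrable (fun x => deriv η x • φ x) leb := by
        obtain ⟨B, hB⟩ := hη.deriv.compact.exists_bound_of_continuous hη.deriv.continuous
        exact hφi.bdd_smul (φ := deriv η) B hη.deriv.continuous.aestronglyMeasurable
          (Eventually.of_forall hB)
      simp only [PiLp.neg_apply] at h2
      rw [integral_apply h4, integral_apply h3] at h2
      simp only [PiLp.smul_apply, Complex.real_smul] at h2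
      have h5 := integral_D0inv_mul_deriv g i hη
      simp only [hmean, PiLp.zero_apply, sub_zero] at h5
      have h6 : ∫ x, ((deriv η x : ℝ) : ℂ) * φ x i ∂leb
          = ∫ x, D0inv g x i * ((deriv η x : ℝ) : ℂ) ∂leb := by
        refine integral_congr_ae ?_
        filter_upwards [ae_mem_Icc leb_compl] with x hx
        rw [heq hx, mul_comm]
      rw [h6, h5, neg_inj] at h2
      simp only [Pi.sub_apply, sub_mul]
      rw [integral_sub (integrable_mul_test (integrable_coe_apply f i) hη)
        (integrable_mul_test (integrable_coe_apply g i) hη), h2, sub_eq_zero]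
      exact integral_congr_ae (Eventually.of_forall fun x => mul_comm _ _)
  filter_upwards [h1] with x hx
  exact sub_eq_zero.1 hx

end Eigenfunctions

/-! ### One-dimensionality of the eigenspaces, by initial slopes and positivity. -/

section Simplicity

/-- Gronwall's lemma for a coupled pair of Volterra inequalities. -/
lemma eq_zero_of_volterra {m n : Measure ℝ} [IsFiniteMeasure m] [IsFiniteMeasure n]
    (hm : m (Icc (-1) 1)ᶜ = 0) (hn : n (Icc (-1) 1)ᶜ = 0) {u v : ℝ → ℝ} {k : ℝ} (hk : 0 ≤ k)
    (hu : ContinuousOn u (Icc (-1) 1)) (hv : ContinuousOn v (Icc (-1) 1))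
    (hu0 : ∀ x ∈ Icc (-1 : ℝ) 1, 0 ≤ u x) (hv0 : ∀ x ∈ Icc (-1 : ℝ) 1, 0 ≤ v x)
    (h1 : ∀ x ∈ Icc (-1 : ℝ) 1, u x ≤ k * ∫ y in Iio x, (x - y) * v y ∂n)
    (h2 : ∀ x ∈ Icc (-1 : ℝ) 1, v x ≤ k * ∫ y in Iio x, (x - y) * u y ∂m) :
    ∀ x ∈ Icc (-1 : ℝ) 1, u x = 0 ∧ v x = 0 := by
  set M := m.real univ + n.real univ with hM
  have hM0 : 0 ≤ M := by positivity
  -- The weight exp(-κ x) makes the Volterra map a contraction: the constant obtained below is k M /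
  -- κ ≤ 1/2, which forces the weighted maximum W to vanish.
  set κ := 2 * k * M + 1 with hκ
  have hκ0 : 0 < κ := by positivity
  obtain ⟨x, hx, hmax⟩ := isCompact_Icc.exists_isMaxOn (⟨0, by simp⟩ : (Icc (-1 : ℝ) 1).Nonempty)
    (((Continuous.continuousOn (by fun_prop : Continuous fun x => Real.exp (-κ * x))).mul
      (hu.add hv)) : ContinuousOn (fun x => Real.exp (-κ * x) * (u x + v x)) (Icc (-1) 1))
  set W := Real.exp (-κ * x) * (u x + v x) with hW
  have hW0 : 0 ≤ W := mul_nonneg (Real.exp_pos _).le (add_nonneg (hu0 x hx) (hv0 x hx))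
  have hb : ∀ y ∈ Icc (-1 : ℝ) 1, u y + v y ≤ Real.exp (κ * y) * W := fun y hy => by
    have h3 : Real.exp (-κ * y) * (u y + v y) ≤ W := hmax hy
    have h4 : Real.exp (κ * y) * Real.exp (-κ * y) = 1 := by
      rw [← Real.exp_add]; simp
    calc u y + v y = Real.exp (κ * y) * (Real.exp (-κ * y) * (u y + v y)) := by
          rw [← mul_assoc, h4, one_mul]
      _ ≤ _ := mul_le_mul_of_nonneg_left h3 (Real.exp_pos _).le
  have hint : ∀ (r : Measure ℝ) [IsFiniteMeasure r], r (Icc (-1) 1)ᶜ = 0 → ∀ w : ℝ → ℝ,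
      (∀ y ∈ Icc (-1 : ℝ) 1, 0 ≤ w y ∧ w y ≤ u y + v y) →
      ∫ y in Iio x, (x - y) * w y ∂r ≤ (Real.exp (κ * x) * W / κ) * r.real univ := by
    intro r _ hr w hw
    have h3 : ∀ᵐ y ∂(r.restrict (Iio x)), ‖(x - y) * w y‖ ≤ Real.exp (κ * x) * W / κ := by
      filter_upwards [ae_restrict_mem measurableSet_Iio, ae_restrict_of_ae (ae_mem_Icc hr)]
        with y hyx hy
      have hxy : 0 ≤ x - y := sub_nonneg.2 (le_of_lt hyx)
      rw [Real.norm_of_nonneg (mul_nonneg hxy (hw y hy).1), le_div_iff₀ hκ0]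
      -- The gain 1/κ comes from the factor x - y of the kernel. The exponential weight alone gives
      -- no smallness for a measure with atoms.
      have h4 : κ * (x - y) ≤ Real.exp (κ * (x - y)) := by
        linarith [Real.add_one_le_exp (κ * (x - y))]
      have h5 : Real.exp (κ * x) = Real.exp (κ * (x - y)) * Real.exp (κ * y) := by
        rw [← Real.exp_add]; congr 1; ring
      calc (x - y) * w y * κ = (κ * (x - y)) * w y := by ring
        _ ≤ Real.exp (κ * (x - y)) * (Real.exp (κ * y) * W) :=
          mul_le_mul h4 ((hw y hy).2.trans (hb y hy)) (hw y hy).1 (Real.exp_pos _).le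
        _ = Real.exp (κ * x) * W := by rw [h5]; ring
    have h6 := norm_integral_le_of_norm_le_const h3
    refine (le_abs_self _).trans (h6.trans (mul_le_mul_of_nonneg_left ?_ (by positivity)))
    rw [measureReal_restrict_apply_univ]
    exact measureReal_mono (subset_univ _)
  have e1 := hint n hn v fun y hy => ⟨hv0 y hy, by linarith [hu0 y hy]⟩
  have e2 := hint m hm u fun y hy => ⟨hu0 y hy, by linarith [hv0 y hy]⟩
  have e3 : u x + v x ≤ k * ((Real.exp (κ * x) * W / κ) * M) := by
    have e4 := (h1 x hx).trans (mul_le_mul_of_nonneg_left e1 hk)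
    have e5 := (h2 x hx).trans (mul_le_mul_of_nonneg_left e2 hk)
    rw [hM]; linarith
  have hexp : Real.exp (-κ * x) * Real.exp (κ * x) = 1 := by
    rw [← Real.exp_add]; simp
  have e6 : W ≤ k * M / κ * W := by
    calc W ≤ Real.exp (-κ * x) * (k * ((Real.exp (κ * x) * W / κ) * M)) :=
          mul_le_mul_of_nonneg_left e3 (Real.exp_pos _).le
      _ = (Real.exp (-κ * x) * Real.exp (κ * x)) * (k * M / κ * W) := by ring
      _ = _ := by rw [hexp, one_mul]
  have e7 : k * M / κ ≤ 1 / 2 := by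
    rw [div_le_iff₀ hκ0, hκ]; linarith
  have hWz : W = 0 := by nlinarith
  intro y hy
  have := hb y hy
  rw [hWz, mul_zero] at this
  constructor <;> linarith [hu0 y hy, hv0 y hy]

/-- Adjointness applied to the indicator of `Iic x`. The primitive splits into a linear part,
carrying the initial slope, and a Volterra part that only sees y < x. -/
lemma setIntegral_D1inv {r : Measure ℝ} [IsFiniteMeasure r] (hr : r (Icc (-1) 1)ᶜ = 0)
    {ψ : ℝ → ℂ} (hψ : Integrable ψ r) {x : ℝ} (hx : x ∈ Icc (-1 : ℝ) 1) :
    ∫ y in Iic x, D1inv r ψ y ∂leb = ((x + 1) / 2 : ℝ) * ∫ y, (y + -1) • ψ y ∂r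
      + ∫ y in Iio x, ((x - y : ℝ) : ℂ) * ψ y ∂r := by
  have hh : Integrable ((Iic x).indicator fun _ => (1 : ℂ)) leb :=
    (integrable_const 1).indicator measurableSet_Iic
  have h1 := integral_D1inv_mul hr hψ hh
  have h2 : ∀ y, D1inv r ψ y * (Iic x).indicator (fun _ => (1 : ℂ)) y
      = (Iic x).indicator (D1inv r ψ) y := fun y => by
    by_cases hy : y ∈ Iic x <;> simp [hy]
  simp only [h2] at h1
  rw [integral_indicator measurableSet_Iic] at h1
  have hxy : Integrable (fun y : ℝ => ((x - y : ℝ) : ℂ) * ψ y) r := by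
    have h3 := (integrable_weight hr hψ (-x)).neg
    refine h3.congr (Eventually.of_forall fun y => ?_)
    simp only [Pi.neg_apply, Complex.real_smul]; push_cast; ring
  rw [h1, ← integral_const_mul, ← integral_indicator measurableSet_Iio, ← integral_add
    ((integrable_weight hr hψ (-1)).const_mul _) (hxy.indicator measurableSet_Iio), ← integral_neg]
  refine integral_congr_ae ?_
  filter_upwards [ae_mem_Icc hr] with y hy
  rw [setIntegral_indicator measurableSet_Iic, Iic_inter_Iic, integral_const,
    integral_indicator measurableSet_Iic, integral_const, measureReal_restrict_apply_univ,
    measureReal_restrict_apply_univ, leb_real_Iic hx]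
  rcases lt_or_ge y x with h | h
  · rw [indicator_of_mem (mem_Iio.2 h), min_eq_left h.le, leb_real_Iic hy]
    simp only [Complex.real_smul]; push_cast; ring
  · rw [indicator_of_notMem (notMem_Iio.2 h), min_eq_right h, leb_real_Iic hx]
    simp only [Complex.real_smul]; push_cast; ring

variable {m n : Measure ℝ} [IsFiniteMeasure m] [IsFiniteMeasure n]

/-- Up to a constant factor, the initial slopes of the solutions. -/
def slope (r : Measure ℝ) (f : Hil) (i : Fin 2) : ℂ := ∫ y, (y + -1) • D0inv f y i ∂r

lemma slope_combination {r : Measure ℝ} [IsFiniteMeasure r] (hr : r (Icc (-1) 1)ᶜ = 0)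
    (a b : ℂ) (f g : Hil) (i : Fin 2) :
    slope r (a • f + b • g) i = a * slope r f i + b * slope r g i := by
  unfold slope
  rw [← integral_const_mul, ← integral_const_mul, ← integral_add
    ((integrable_weight hr (integrable_D0inv hr f i) (-1)).const_mul _)
    ((integrable_weight hr (integrable_D0inv hr g i) (-1)).const_mul _)]
  refine integral_congr_ae (Eventually.of_forall fun y => ?_)
  simp only [D0inv_add, D0inv_smul, PiLp.add_apply, PiLp.smul_apply, Complex.real_smul, smul_eq_mul]
  ring

variable (hm : m (Icc (-1) 1)ᶜ = 0) (hn : n (Icc (-1) 1)ᶜ = 0)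

include hm hn

/-- This turns the boundary value problem into an initial value problem at -1 with the slopes as
parameters. -/
lemma D0inv_repr {l : ℂ} {f : Hil} (h : l • T m n f = f) {x : ℝ} (hx : x ∈ Icc (-1 : ℝ) 1) :
    D0inv f x 0 = l * (((x + 1) / 2 : ℝ) * slope n f 1
      + ∫ y in Iio x, ((x - y : ℝ) : ℂ) * D0inv f y 1 ∂n) ∧
    D0inv f x 1 = l * (((x + 1) / 2 : ℝ) * slope m f 0
      + ∫ y in Iio x, ((x - y : ℝ) : ℂ) * D0inv f y 0 ∂m) := by
  have hmean : mean f = 0 := by rw [← h, mean_smul, mean_T hm hn, smul_zero]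
  have hI : ∀ i, ∫ y, f y i ∂leb = 0 := fun i => by
    have h1 := mean_apply f i
    rw [hmean] at h1
    simpa using h1.symm
  have hfa := Lp.coeFn_smul l (T m n f)
  rw [h] at hfa
  constructor
  · rw [D0inv_apply_eq f 0 hx, hI, mul_zero, sub_zero, slope,
      ← setIntegral_D1inv hn (integrable_D0inv hn f 1) hx, ← integral_const_mul]
    refine integral_congr_ae (ae_restrict_of_ae ?_)
    filter_upwards [hfa, T_apply_zero (m := m) (n := n) f] with y h2 h3
    rw [h2, Pi.smul_apply, PiLp.smul_apply, h3, smul_eq_mul]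
  · rw [D0inv_apply_eq f 1 hx, hI, mul_zero, sub_zero, slope,
      ← setIntegral_D1inv hm (integrable_D0inv hm f 0) hx, ← integral_const_mul]
    refine integral_congr_ae (ae_restrict_of_ae ?_)
    filter_upwards [hfa, T_apply_one (m := m) (n := n) f] with y h2 h3
    rw [h2, Pi.smul_apply, PiLp.smul_apply, h3, smul_eq_mul]

/-- Uniqueness for the initial value problem: with zero slopes only the Volterra terms remain, and
Gronwall applies to the absolute values. -/
lemma eq_zero_of_slope {l : ℂ} {f : Hil} (h : l • T m n f = f) (h0 : slope n f 1 = 0)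
    (h1 : slope m f 0 = 0) : f = 0 := by
  have hb : ∀ (r : Measure ℝ) [IsFiniteMeasure r] (i : Fin 2) (x : ℝ),
      ‖∫ y in Iio x, ((x - y : ℝ) : ℂ) * D0inv f y i ∂r‖
        ≤ ∫ y in Iio x, (x - y) * ‖D0inv f y i‖ ∂r := fun r _ i x => by
    refine (norm_integral_le_integral_norm _).trans (le_of_eq ?_)
    refine setIntegral_congr_fun measurableSet_Iio fun y hy => ?_
    simp only
    rw [norm_mul, Complex.norm_real, Real.norm_of_nonneg (sub_nonneg.2 (le_of_lt hy))]
  have key := eq_zero_of_volterra hm hn (norm_nonneg l) (continuousOn_D0inv_apply f 0).norm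
    (continuousOn_D0inv_apply f 1).norm (fun x _ => norm_nonneg _) (fun x _ => norm_nonneg _)
    (fun x hx => by
      rw [(D0inv_repr hm hn h hx).1, h0, mul_zero, zero_add, norm_mul]
      exact mul_le_mul_of_nonneg_left (hb n 1 x) (norm_nonneg _))
    (fun x hx => by
      rw [(D0inv_repr hm hn h hx).2, h1, mul_zero, zero_add, norm_mul]
      exact mul_le_mul_of_nonneg_left (hb m 0 x) (norm_nonneg _))
  rw [← h, T_eq_zero_of_D0inv hm hn, smul_zero]
  intro x hx
  ext i
  fin_cases i
  · simpa using (key x hx).1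
  · simpa using (key x hx).2

/-- Positivity of the solution with initial slopes `1` and `sign t`. -/
lemma slope_ne {t s : ℝ} (hs : s * s = 1) (hst : 0 ≤ s * t) {f : Hil}
    (h : (t : ℂ) • T m n f = f) (h0 : (t : ℂ) * slope n f 1 = 1)
    (h1 : (t : ℂ) * slope m f 0 = s) : False := by
  have hre : ∀ (r : Measure ℝ) [IsFiniteMeasure r] (_ : r (Icc (-1) 1)ᶜ = 0) (i : Fin 2) (x : ℝ),
      (∫ y in Iio x, ((x - y : ℝ) : ℂ) * D0inv f y i ∂r).re
        = ∫ y in Iio x, (x - y) * (D0inv f y i).re ∂r := fun r _ hr i x => by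
    have hi : Integrable (fun y : ℝ => ((x - y : ℝ) : ℂ) * D0inv f y i) r := by
      refine (integrable_weight hr (integrable_D0inv hr f i) (-x)).neg.congr
        (Eventually.of_forall fun y => ?_)
      simp only [Pi.neg_apply, Complex.real_smul]; push_cast; ring
    have h3 := integral_re (𝕜 := ℂ) (hi.integrableOn (s := Iio x))
    simp only [RCLike.re_eq_complex_re, Complex.re_ofReal_mul] at h3
    exact h3.symm
  -- Here s t = |t|. After the sign s is moved into the second component, both real parts solve u =
  -- (x + 1)/2 + |t| ∫ (x - y) v, with nonnegative coefficients.
  set u : ℝ → ℝ := fun x => (D0inv f x 0).re with hu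
  set v : ℝ → ℝ := fun x => s * (D0inv f x 1).re with hv
  have huc : ContinuousOn u (Icc (-1) 1) :=
    Complex.continuous_re.comp_continuousOn (continuousOn_D0inv_apply f 0)
  have hvc : ContinuousOn v (Icc (-1) 1) :=
    (Complex.continuous_re.comp_continuousOn (continuousOn_D0inv_apply f 1)).const_mul s
  have hur : ∀ x ∈ Icc (-1 : ℝ) 1,
      u x = (x + 1) / 2 + (s * t) * ∫ y in Iio x, (x - y) * v y ∂n := fun x hx => by
    have h2 := (D0inv_repr hm hn h hx).1
    have h3 : D0inv f x 0 = (((x + 1) / 2 : ℝ) : ℂ)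
        + (t : ℂ) * ∫ y in Iio x, ((x - y : ℝ) : ℂ) * D0inv f y 1 ∂n := by
      rw [h2]; linear_combination (((x + 1) / 2 : ℝ) : ℂ) * h0
    have h4 : ∫ y in Iio x, (x - y) * v y ∂n = s * ∫ y in Iio x, (x - y) * (D0inv f y 1).re ∂n := by
      rw [← integral_const_mul]
      exact integral_congr_ae (Eventually.of_forall fun y => by simp only [hv]; ring)
    rw [hu]; simp only
    rw [h3, h4, Complex.add_re, Complex.ofReal_re, Complex.re_ofReal_mul, hre n hn]
    linear_combination (-t * ∫ y in Iio x, (x - y) * (D0inv f y 1).re ∂n) * hs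
  have hvr : ∀ x ∈ Icc (-1 : ℝ) 1,
      v x = (x + 1) / 2 + (s * t) * ∫ y in Iio x, (x - y) * u y ∂m := fun x hx => by
    have h2 := (D0inv_repr hm hn h hx).2
    have h3 : D0inv f x 1 = (((x + 1) / 2 * s : ℝ) : ℂ)
        + (t : ℂ) * ∫ y in Iio x, ((x - y : ℝ) : ℂ) * D0inv f y 0 ∂m := by
      rw [h2]; push_cast at h1 ⊢; linear_combination (((x : ℂ) + 1) / 2) * h1
    rw [hv]; simp only
    rw [h3, Complex.add_re, Complex.ofReal_re, Complex.re_ofReal_mul, hre m hm]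
    linear_combination ((x + 1) / 2) * hs
  have hneg : ∀ (r : Measure ℝ) [IsFiniteMeasure r] (_ : r (Icc (-1) 1)ᶜ = 0) (w : ℝ → ℝ)
      (_ : ContinuousOn w (Icc (-1) 1)) (x : ℝ),
      -∫ y in Iio x, (x - y) * w y ∂r ≤ ∫ y in Iio x, (x - y) * max (-w y) 0 ∂r := by
    intro r _ hr w hw x
    have hi : ∀ w : ℝ → ℝ, ContinuousOn w (Icc (-1) 1) →
        IntegrableOn (fun y => (x - y) * w y) (Iio x) r := fun w hw => by
      have h3 : ContinuousOn (fun y => (x - y) * w y) (Icc (-1) 1) :=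
        (Continuous.continuousOn (by fun_prop)).mul hw
      have h4 : IntegrableOn (fun y => (x - y) * w y) (Icc (-1) 1) r := h3.integrableOn_Icc
      rw [IntegrableOn, Measure.restrict_eq_self_of_ae_mem (ae_mem_Icc hr)] at h4
      exact h4.integrableOn
    rw [← integral_neg]
    refine setIntegral_mono_on (hi w hw).neg (hi _ (hw.neg.sup continuousOn_const))
      measurableSet_Iio fun y hy => ?_
    rw [← mul_neg]
    exact mul_le_mul_of_nonneg_left (le_max_left _ _) (sub_nonneg.2 (le_of_lt hy))
  have hnn : ∀ (r : Measure ℝ) (w : ℝ → ℝ) (x : ℝ),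
      0 ≤ ∫ y in Iio x, (x - y) * max (-w y) 0 ∂r := fun r w x =>
    setIntegral_nonneg measurableSet_Iio fun y hy =>
      mul_nonneg (sub_nonneg.2 (le_of_lt hy)) (le_max_right _ _)
  -- Gronwall is applied to the negative parts of u and v: the inhomogeneous term (x + 1)/2 is
  -- nonnegative and may be dropped.
  have key := eq_zero_of_volterra hm hn hst (huc.neg.sup continuousOn_const)
    (hvc.neg.sup continuousOn_const) (fun x _ => le_max_right _ _) (fun x _ => le_max_right _ _)
    (fun x hx => by
      refine max_le ?_ (mul_nonneg hst (hnn n v x))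
      have h3 := mul_le_mul_of_nonneg_left (hneg n hn v hvc x) hst
      have h4 := hur x hx
      simp only [Pi.neg_apply]
      linarith [hx.1])
    (fun x hx => by
      refine max_le ?_ (mul_nonneg hst (hnn m u x))
      have h3 := mul_le_mul_of_nonneg_left (hneg m hm u huc x) hst
      have h4 := hvr x hx
      simp only [Pi.neg_apply]
      linarith [hx.1])
  have h5 : 0 ≤ ∫ y in Iio 1, (1 - y) * v y ∂n := by
    refine integral_nonneg_of_ae ?_
    filter_upwards [ae_restrict_of_ae (ae_mem_Icc hn)] with y hy
    have h6 := (key y hy).2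
    have h7 : 0 ≤ v y := by
      have := le_max_left (-v y) 0
      simp only [Pi.neg_apply] at h6
      linarith [le_of_le_of_eq this h6]
    exact mul_nonneg (sub_nonneg.2 hy.2) h7
  -- At the right end point the representation gives u 1 ≥ 1, against the boundary condition.
  have h8 := hur 1 (by simp)
  have h9 : u 1 = 0 := by simp only [hu, D0inv_right]; simp
  rw [h9] at h8
  nlinarith [mul_nonneg hst h5]

/-- The eigenspaces of `T` for real eigenvalues are one-dimensional. -/
theorem exists_smul_of_eigenvectors {t : ℝ} {f g : Hil} (hf0 : f ≠ 0)
    (hf : (t : ℂ) • T m n f = f) (hg : (t : ℂ) • T m n g = g) : ∃ c : ℂ, g = c • f := by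
  have ht : (t : ℂ) ≠ 0 := fun h => hf0 (by rw [← hf, h, zero_smul])
  have hcomb : ∀ a b : ℂ, (t : ℂ) • T m n (a • f + b • g) = a • f + b • g := fun a b => by
    rw [map_add, map_smul, map_smul, smul_add, smul_comm _ a, smul_comm _ b, hf, hg]
  obtain ⟨s, hs, hst⟩ : ∃ s : ℝ, s * s = 1 ∧ 0 ≤ s * t := by
    rcases le_total 0 t with h | h
    · exact ⟨1, by norm_num, by simpa using h⟩
    · exact ⟨-1, by norm_num, by simpa using h⟩
  set v0 := slope n f 1 with hv0
  set v1 := slope m f 0 with hv1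
  set w0 := slope n g 1 with hw0
  set w1 := slope m g 0 with hw1
  -- If the slope vectors were independent, Cramer's rule would give a combination with the slopes
  -- excluded by `slope_ne`.
  have hdet : v0 * w1 - v1 * w0 = 0 := by
    by_contra hd
    set d := v0 * w1 - v1 * w0 with hdd
    refine slope_ne hm hn hs hst (hcomb ((w1 - s * w0) / (t * d)) ((v0 * s - v1) / (t * d))) ?_ ?_
    · rw [slope_combination hn, ← hv0, ← hw0]
      field_simp
      rw [hdd]; ring
    · rw [slope_combination hm, ← hv1, ← hw1]
      field_simp
      rw [hdd]; ring
  -- The slope vector of f is not zero, so that of g is a multiple of it; the same multiple relates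
  -- g and f, by uniqueness.
  by_cases h0 : v0 = 0
  · by_cases h1 : v1 = 0
    · exact absurd (eq_zero_of_slope hm hn hf h0 h1) hf0
    · refine ⟨w1 / v1, ?_⟩
      have h2 := eq_zero_of_slope hm hn (hcomb (-(w1 / v1)) 1)
        (by rw [slope_combination hn, ← hv0, ← hw0, h0]
            rw [h0] at hdet
            have : w0 = 0 := by
              have h3 : v1 * w0 = 0 := by linear_combination -hdet
              exact (mul_eq_zero.1 h3).resolve_left h1
            rw [this]; ring)
        (by rw [slope_combination hm, ← hv1, ← hw1]; field_simp; ring)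
      rw [one_smul, neg_smul, neg_add_eq_zero] at h2
      exact h2.symm
  · refine ⟨w0 / v0, ?_⟩
    have h2 := eq_zero_of_slope hm hn (hcomb (-(w0 / v0)) 1)
      (by rw [slope_combination hn, ← hv0, ← hw0]; field_simp; ring)
      (by rw [slope_combination hm, ← hv1, ← hw1]; field_simp; linear_combination hdet)
    rw [one_smul, neg_smul, neg_add_eq_zero] at h2
    exact h2.symm

end Simplicity

/-! ### The energy operator -J T and its Hilbert-Schmidt square root. -/

section Operators

open scoped InnerProductSpace

/-- Positive operators have symmetric square roots. -/
lemma exists_symm_sqrt {H : Type} [NormedAddCommGroup H] [InnerProductSpace ℂ H] [CompleteSpace H]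
    {Q : H →L[ℂ] H} (hQ : 0 ≤ Q) :
    ∃ q : H →L[ℂ] H, (∀ x y, ⟪q x, y⟫_ℂ = ⟪x, q y⟫_ℂ) ∧ ∀ x, q (q x) = Q x := by
  have h : 0 ≤ CFC.sqrt Q := CFC.sqrt_nonneg _
  refine ⟨CFC.sqrt Q, fun x y => ?_, fun x => ?_⟩
  · rw [ContinuousLinearMap.nonneg_iff_isPositive] at h
    exact h.isSymmetric x y
  · exact congrArg (fun A : H →L[ℂ] H => A x) (CFC.sqrt_mul_sqrt_self Q hQ)

/-- Interchange of the two components of a function in `L²([-1, 1]; ℂ²)`. -/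
def swap : Hil →L[ℂ] Hil :=
  ContinuousLinearMap.compLpL 2 leb
    ((LinearIsometryEquiv.piLpCongrLeft 2 ℂ ℂ (Equiv.swap (0 : Fin 2) 1)).toContinuousLinearEquiv :
      Vec →L[ℂ] Vec)

lemma swap_ae (f : Hil) : ∀ᵐ x ∂leb, swap f x 0 = f x 1 ∧ swap f x 1 = f x 0 := by
  filter_upwards [ContinuousLinearMap.coeFn_compLpL (p := 2) (μ := leb)
    ((LinearIsometryEquiv.piLpCongrLeft 2 ℂ ℂ (Equiv.swap (0 : Fin 2) 1)).toContinuousLinearEquiv :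
      Vec →L[ℂ] Vec) f] with x hx
  rw [swap, hx]
  constructor <;> simp [LinearIsometryEquiv.piLpCongrLeft_apply, Equiv.piCongrLeft'_apply]

lemma swap_swap (f : Hil) : swap (swap f) = f := by
  refine ext_apply fun i => ?_
  fin_cases i
  · filter_upwards [swap_ae f, swap_ae (swap f)] with x h1 h2
    exact h2.1.trans h1.2
  · filter_upwards [swap_ae f, swap_ae (swap f)] with x h1 h2
    exact h2.2.trans h1.1

lemma inner_eq_integral (f g : Hil) :
    ⟪f, g⟫_ℂ = ∫ x, (g x 0 * conj (f x 0) + g x 1 * conj (f x 1)) ∂leb := by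
  rw [L2.inner_def]
  refine integral_congr_ae (Eventually.of_forall fun x => ?_)
  simp [PiLp.inner_apply, Fin.sum_univ_two]

lemma inner_swap_left (f g : Hil) : ⟪swap f, g⟫_ℂ = ⟪f, swap g⟫_ℂ := by
  rw [inner_eq_integral, inner_eq_integral]
  refine integral_congr_ae ?_
  filter_upwards [swap_ae f, swap_ae g] with x h1 h2
  rw [h1.1, h1.2, h2.1, h2.2, add_comm]

lemma form_eq_inner (f g : Hil) : form f g = ⟪swap g, f⟫_ℂ := by
  rw [inner_eq_integral, form]
  refine integral_congr_ae ?_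
  filter_upwards [swap_ae g] with x h1
  rw [h1.1, h1.2]

lemma D0inv_swap (f : Hil) {x : ℝ} (hx : x ∈ Icc (-1 : ℝ) 1) :
    D0inv (swap f) x 0 = D0inv f x 1 ∧ D0inv (swap f) x 1 = D0inv f x 0 := by
  have h0 : ∀ᵐ x ∂leb, swap f x 0 = f x 1 := (swap_ae f).mono fun x h => h.1
  have h1 : ∀ᵐ x ∂leb, swap f x 1 = f x 0 := (swap_ae f).mono fun x h => h.2
  simp only [D0inv_apply_eq _ _ hx, integral_congr_ae h0, integral_congr_ae h1,
    integral_congr_ae (ae_restrict_of_ae h0), integral_congr_ae (ae_restrict_of_ae h1), and_self]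

lemma integrable_mul_conj (f g : Hil) (i j : Fin 2) :
    Integrable (fun x => f x i * conj (g x j)) leb :=
  ((Lp.memLp f).eval_piLp i).integrable_mul ((Lp.memLp g).eval_piLp j).star

variable {m n : Measure ℝ} [IsFiniteMeasure m] [IsFiniteMeasure n]

/-- The nonnegative operator `-J T`, with `J` the interchange of components. -/
def energy (m n : Measure ℝ) [IsFiniteMeasure m] [IsFiniteMeasure n] : Hil →L[ℂ] Hil :=
  -(swap * T m n)

lemma T_eq_energy (f : Hil) : T m n f = -swap (energy m n f) := by
  change T m n f = -swap (-swap (T m n f))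
  rw [map_neg, swap_swap, neg_neg]

/-- Values of `D₀⁻¹` on orthonormal families. -/
lemma sum_norm_D0inv_le {κ : Type} [Fintype κ] {e : κ → Hil} (he : Orthonormal ℂ e) (x : ℝ)
    (j : Fin 2) : ∑ i, ‖D0inv (e i) x j‖ ^ 2 ≤ 16 := by
  let L : Hil →L[ℂ] ℂ := LinearMap.mkContinuous
    { toFun := fun f => D0inv f x j
      map_add' := fun f g => by simp [D0inv_add]
      map_smul' := fun c f => by simp [D0inv_smul] } 4 (fun f => norm_D0inv_apply_le f j x)
  have hL : ‖L‖ ≤ 4 := LinearMap.mkContinuous_norm_le _ (by norm_num) _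
  -- Point evaluation of D₀⁻¹ is represented by a vector of norm at most 4, and Bessel's inequality
  -- gives 4² = 16, uniformly in x and in the family.
  let k := (InnerProductSpace.toDual ℂ Hil).symm L
  have hk : ‖k‖ ≤ 4 := by rw [LinearIsometryEquiv.norm_map]; exact hL
  have h1 : ∀ f, ⟪k, f⟫_ℂ = D0inv f x j := fun f => InnerProductSpace.toDual_symm_apply
  calc ∑ i, ‖D0inv (e i) x j‖ ^ 2 = ∑ i, ‖⟪e i, k⟫_ℂ‖ ^ 2 := by
        refine Finset.sum_congr rfl fun i _ => ?_
        rw [← h1, norm_inner_symm]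
    _ ≤ ‖k‖ ^ 2 := he.sum_inner_products_le k
    _ ≤ 16 := by nlinarith [norm_nonneg k]

variable (hm : m (Icc (-1) 1)ᶜ = 0) (hn : n (Icc (-1) 1)ᶜ = 0)

include hm hn

/-- The adjointness of D₁⁻¹ and -D₀⁻¹ makes the form of -J T an L² pairing of the potentials D₀⁻¹ f
and D₀⁻¹ g, visibly Hermitian and nonnegative. -/
lemma inner_energy (f g : Hil) :
    ⟪g, energy m n f⟫_ℂ = ∫ y, D0inv f y 1 * conj (D0inv g y 1) ∂n
      + ∫ y, D0inv f y 0 * conj (D0inv g y 0) ∂m := by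
  have h1 : ⟪g, energy m n f⟫_ℂ = -⟪swap g, T m n f⟫_ℂ := by
    rw [inner_swap_left, ← inner_neg_right]; rfl
  have h2 : ⟪swap g, T m n f⟫_ℂ
      = ∫ x, (T m n f x 0 * conj (g x 1) + T m n f x 1 * conj (g x 0)) ∂leb := by
    rw [← form_eq_inner, form]
  have h3 : ∫ x, T m n f x 0 * conj (g x 1) ∂leb
      = ∫ x, D1inv n (fun y => D0inv f y 1) x * conj (g x 1) ∂leb :=
    integral_congr_ae ((T_apply_zero (m := m) (n := n) f).mono fun x hx => by simp only [hx])
  have h4 : ∫ x, T m n f x 1 * conj (g x 0) ∂leb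
      = ∫ x, D1inv m (fun y => D0inv f y 0) x * conj (g x 0) ∂leb :=
    integral_congr_ae ((T_apply_one (m := m) (n := n) f).mono fun x hx => by simp only [hx])
  rw [h1, h2, integral_add (integrable_mul_conj _ _ _ _) (integrable_mul_conj _ _ _ _), h3, h4,
    integral_D1inv_mul_conj hn (integrable_D0inv hn f 1),
    integral_D1inv_mul_conj hm (integrable_D0inv hm f 0)]
  ring

lemma inner_energy_self (f : Hil) :
    ⟪f, energy m n f⟫_ℂ
      = ((∫ y, ‖D0inv f y 1‖ ^ 2 ∂n + ∫ y, ‖D0inv f y 0‖ ^ 2 ∂m : ℝ) : ℂ) := by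
  rw [inner_energy hm hn, Complex.ofReal_add, ← integral_complex_ofReal, ← integral_complex_ofReal]
  simp only [Complex.mul_conj, Complex.normSq_eq_norm_sq]

lemma energy_symm (f g : Hil) : ⟪energy m n f, g⟫_ℂ = ⟪f, energy m n g⟫_ℂ := by
  rw [← inner_conj_symm, inner_energy hm hn, inner_energy hm hn, map_add, ← integral_conj,
    ← integral_conj]
  simp only [map_mul, Complex.conj_conj, mul_comm]

lemma energy_nonneg : 0 ≤ energy m n := by
  rw [ContinuousLinearMap.nonneg_iff_isPositive]
  refine ⟨fun f g => energy_symm hm hn f g, fun f => ?_⟩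
  rw [ContinuousLinearMap.reApplyInnerSelf_apply, energy_symm hm hn, inner_energy_self hm hn,
    RCLike.re_eq_complex_re, Complex.ofReal_re]
  positivity

variable {q : Hil →L[ℂ] Hil} (hqs : ∀ f g, ⟪q f, g⟫_ℂ = ⟪f, q g⟫_ℂ)
  (hqq : ∀ f, q (q f) = energy m n f)

include hqs hqq

lemma norm_energySqrt_sq (f : Hil) : ‖q f‖ ^ 2
    = ∫ y, ‖D0inv f y 1‖ ^ 2 ∂n + ∫ y, ‖D0inv f y 0‖ ^ 2 ∂m := by
  have h := inner_energy_self hm hn f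
  rw [← hqq, ← hqs, inner_self_eq_norm_sq_to_K] at h
  exact Complex.ofReal_injective (by rw [← h]; push_cast; rfl)

omit hm hn hqs hqq in
lemma integrable_norm_D0inv_sq (r : Measure ℝ) [IsFiniteMeasure r] (hr : r (Icc (-1) 1)ᶜ = 0)
    (f : Hil) (i : Fin 2) : Integrable (fun y => ‖D0inv f y i‖ ^ 2) r := by
  have h : IntegrableOn (fun y => ‖D0inv f y i‖ ^ 2) (Icc (-1) 1) r :=
    ((continuousOn_D0inv_apply f i).norm.pow 2).integrableOn_Icc
  rwa [IntegrableOn, Measure.restrict_eq_self_of_ae_mem (ae_mem_Icc hr)] at h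

/-- The pointwise Bessel bound for D₀⁻¹ is integrated against the finite measures m and n. -/
lemma hsBound_energySqrt : HSBound q (16 * n.real univ + 16 * m.real univ) := by
  intro κ _ e he
  have hle : ∀ (r : Measure ℝ) [IsFiniteMeasure r] (_ : r (Icc (-1) 1)ᶜ = 0) (j : Fin 2),
      ∑ i, ∫ y, ‖D0inv (e i) y j‖ ^ 2 ∂r ≤ 16 * r.real univ := fun r _ hr j => by
    rw [← integral_finsetSum _ fun i _ => integrable_norm_D0inv_sq r hr (e i) j]
    have h := integral_mono (integrable_finsetSum _ fun i _ => integrable_norm_D0inv_sq r hr (e i) j)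
      (integrable_const (μ := r) (16 : ℝ)) fun x => sum_norm_D0inv_le he x j
    rwa [integral_const, smul_eq_mul, mul_comm] at h
  simp only [norm_energySqrt_sq hm hn hqs hqq, Finset.sum_add_distrib]
  exact add_le_add (hle n hn 1) (hle m hm 0)

/-- The kernel of `q` is described by φ₂ = 0 n-almost everywhere and φ₁ = 0 m-almost everywhere, for
φ = D₀⁻¹ f. This is symmetric in the two components because m and n have the same null sets; it is
here that the comparison of the two measures enters. -/
lemma ker_energySqrt_swap (hmn : m ≪ n) (hnm : n ≪ m) (f : Hil) (hf : q f = 0) :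
    q (swap f) = 0 := by
  have h1 := norm_energySqrt_sq hm hn hqs hqq f
  rw [hf, norm_zero, zero_pow two_ne_zero] at h1
  have hp1 : 0 ≤ ∫ y, ‖D0inv f y 1‖ ^ 2 ∂n := integral_nonneg fun _ => by positivity
  have hp0 : 0 ≤ ∫ y, ‖D0inv f y 0‖ ^ 2 ∂m := integral_nonneg fun _ => by positivity
  have h2 := (integral_eq_zero_iff_of_nonneg (fun _ => by positivity)
    (integrable_norm_D0inv_sq n hn f 1)).1 (by linarith)
  have h3 := (integral_eq_zero_iff_of_nonneg (fun _ => by positivity)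
    (integrable_norm_D0inv_sq m hm f 0)).1 (by linarith)
  have h4 := norm_energySqrt_sq hm hn hqs hqq (swap f)
  have h5 : ∫ y, ‖D0inv (swap f) y 1‖ ^ 2 ∂n = 0 := by
    refine integral_eq_zero_of_ae ?_
    filter_upwards [ae_mem_Icc hn, hnm.ae_le h3] with y hy h
    rw [(D0inv_swap f hy).2]; exact h
  have h6 : ∫ y, ‖D0inv (swap f) y 0‖ ^ 2 ∂m = 0 := by
    refine integral_eq_zero_of_ae ?_
    filter_upwards [ae_mem_Icc hm, hmn.ae_le h2] with y hy h
    rw [(D0inv_swap f hy).1]; exact h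
  rw [h5, h6, add_zero] at h4
  exact norm_eq_zero.1 (pow_eq_zero_iff two_ne_zero |>.1 h4)

omit hqs hqq in
/-- The eigenfunctions form a complete system of eigenvectors of `T`. -/
theorem isEigenSystem (hmn : m ≪ n) (hnm : n ≪ m) (f : eigenvalues m n → Hil)
    (hf : ∀ ν : eigenvalues m n, IsEigenfunction m n ν (f ν)) :
    ∃ q, IsEigenSystem swap q (T m n) (fun ν : eigenvalues m n => (ν : ℂ)⁻¹) f := by
  obtain ⟨q, hqs, hqq⟩ := exists_symm_sqrt (energy_nonneg hm hn)
  have hev := fun ν => (hf ν).eigenvector hm hn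
  have hne : ∀ ν : eigenvalues m n, (ν : ℂ) ≠ 0 := fun ν h => (hev ν).1 (by
    rw [← (hev ν).2, h, zero_smul])
  have hT : ∀ x, T m n x = -swap (q (q x)) := fun x => by
    rw [hqq, ← T_eq_energy]
  refine ⟨q, swap_swap, inner_swap_left, hqs, hT,
    ker_energySqrt_swap hm hn hqs hqq hmn hnm, ⟨_, hsBound_energySqrt hm hn hqs hqq⟩,
    fun a b h => Subtype.ext (inv_injective h), fun ν => inv_ne_zero (hne ν), fun ν => (hev ν).1,
    fun ν => ?_, fun t x ht hx hx0 => ?_⟩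
  · rw [eq_inv_smul_iff₀ (hne ν), (hev ν).2]
  -- Simplicity is available for real eigenvalues only, so reality, which follows from the abstract
  -- structure, has to come first.
  · have hreal := conj_eigenvalue inner_swap_left hqs hT ht hx0 hx
    have h1 : t⁻¹ • T m n x = x := by rw [hx, smul_smul, inv_mul_cancel₀ ht, one_smul]
    let ν : eigenvalues m n := ⟨t⁻¹, mem_eigenvalues_of_T hm hn hx0 h1⟩
    obtain ⟨s, hs⟩ := Complex.conj_eq_iff_real.1 hreal
    have h2 : t⁻¹ = ((s⁻¹ : ℝ) : ℂ) := by rw [hs]; push_cast; rfl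
    have h3 := (hev ν).2
    change t⁻¹ • T m n (f ν) = f ν at h3
    rw [h2] at h1 h3
    exact ⟨ν, exists_smul_of_eigenvectors hm hn (hev ν).1 h3 h1⟩

end Operators

/-! ### Integral operators with matrix kernels and convergence of the kernels. -/

section Kernel

attribute [local instance] Matrix.frobeniusNormedSpace

open scoped InnerProductSpace

/-- Matrices of size two, normed by the Frobenius norm. -/
abbrev Mat : Type := Matrix (Fin 2) (Fin 2) ℂ

lemma norm_toLp_mulVec_le (M : Mat) (v : Vec) : ‖WithLp.toLp 2 (Matrix.mulVec M v)‖ ≤ ‖M‖ * ‖v‖ := by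
  have h := Matrix.frobenius_norm_mul M (Matrix.replicateCol Unit (v : Fin 2 → ℂ))
  rwa [← Matrix.replicateCol_mulVec, Matrix.frobenius_norm_replicateCol,
    Matrix.frobenius_norm_replicateCol] at h

/-- The entries of a matrix as a vector of a Euclidean space. -/
abbrev Entries : Type := EuclideanSpace ℂ (Fin 2 × Fin 2)

/-- The matrix with given entries. -/
def toMat (w : Entries) : Mat := Matrix.of fun i j => w (i, j)

lemma toMat_sub (w w' : Entries) : toMat (w - w') = toMat w - toMat w' := rfl

lemma toMat_smul (c : ℂ) (w : Entries) : toMat (c • w) = c • toMat w := rfl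

lemma toMat_sum {ι : Type*} (s : Finset ι) (w : ι → Entries) :
    toMat (∑ i ∈ s, w i) = ∑ i ∈ s, toMat (w i) := by
  ext i j
  simp [toMat, Matrix.sum_apply]

/-- This isometry allows convergence to be proved in the complete space L² of `Entries` and carried
over to matrices with the Frobenius norm. -/
lemma norm_toMat (w : Entries) : ‖toMat w‖ = ‖w‖ := by
  rw [Matrix.frobenius_norm_def, EuclideanSpace.norm_eq, Real.sqrt_eq_rpow, Fintype.sum_prod_type]
  simp [toMat]

lemma continuous_toMat : Continuous toMat :=
  continuous_matrix fun i j => (EuclideanSpace.proj (𝕜 := ℂ) (i, j)).continuous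

/-- The action of matrices, given by their entries, on vectors. -/
def act (w : Entries) (v : Vec) : Vec := WithLp.toLp 2 (Matrix.mulVec (toMat w) v)

lemma norm_act_le (w : Entries) (v : Vec) : ‖act w v‖ ≤ ‖w‖ * ‖v‖ := by
  rw [← norm_toMat]; exact norm_toLp_mulVec_le _ _

lemma act_sub (w w' : Entries) (v : Vec) : act (w - w') v = act w v - act w' v := by
  rw [act, toMat_sub, Matrix.sub_mulVec, WithLp.toLp_sub]; rfl

lemma act_smul (c : ℂ) (w : Entries) (v : Vec) : act (c • w) v = c • act w v := by
  rw [act, toMat_smul, Matrix.smul_mulVec, WithLp.toLp_smul]; rfl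

lemma act_sum {ι : Type*} (s : Finset ι) (w : ι → Entries) (v : Vec) :
    act (∑ i ∈ s, w i) v = ∑ i ∈ s, act (w i) v := by
  rw [act, toMat_sum, Matrix.sum_mulVec, WithLp.toLp_sum]; rfl

lemma continuous_act : Continuous fun p : Entries × Vec => act p.1 p.2 := by
  refine (PiLp.continuous_toLp 2 _).comp ?_
  exact (continuous_toMat.comp continuous_fst).matrix_mulVec
    ((PiLp.continuous_ofLp 2 _).comp continuous_snd)

/-- The integral operator with kernel `K`. -/
def kernelOp (K : ℝ × ℝ → Entries) (h : ℝ → Vec) (x : ℝ) : Vec :=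
  ∫ y, act (K (x, y)) (h y) ∂leb

variable {K K' : ℝ × ℝ → Entries}

lemma eLpNorm_two {α E : Type*} [MeasurableSpace α] [NormedAddCommGroup E] {μ : Measure α}
    (g : α → E) : eLpNorm g 2 μ = (∫⁻ x, ‖g x‖ₑ ^ (2 : ℝ) ∂μ) ^ (1 / (2 : ℝ)) := by
  simp [eLpNorm_eq_lintegral_rpow_enorm_toReal (two_ne_zero) (ENNReal.ofNat_ne_top)]

lemma aestronglyMeasurable_integrand (hK : AEStronglyMeasurable K (leb.prod leb)) (h : Hil) :
    AEStronglyMeasurable (fun p : ℝ × ℝ => act (K p) (h p.2)) (leb.prod leb) :=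
  continuous_act.comp_aestronglyMeasurable₂ hK (Lp.aestronglyMeasurable h).comp_snd

lemma aestronglyMeasurable_kernelOp (hK : AEStronglyMeasurable K (leb.prod leb)) (h : Hil) :
    AEStronglyMeasurable (kernelOp K h) leb :=
  (aestronglyMeasurable_integrand hK h).integral_prod_right'

lemma lintegral_enorm_integrand_le (h : Hil) {x : ℝ}
    (hx : AEStronglyMeasurable (fun y => K (x, y)) leb) :
    ∫⁻ y, ‖act (K (x, y)) (h y)‖ₑ ∂leb
      ≤ (∫⁻ y, ‖K (x, y)‖ₑ ^ (2 : ℝ) ∂leb) ^ (1 / (2 : ℝ)) * eLpNorm h 2 leb := by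
  rw [eLpNorm_two]
  refine le_trans (lintegral_mono fun y => ?_) (ENNReal.lintegral_mul_le_Lp_mul_Lq leb
    Real.HolderConjugate.two_two hx.enorm (Lp.aestronglyMeasurable h).enorm)
  rw [Pi.mul_apply, ← ofReal_norm, ← ofReal_norm, ← ofReal_norm,
    ← ENNReal.ofReal_mul (norm_nonneg _)]
  exact ENNReal.ofReal_le_ofReal (norm_act_le _ _)

lemma lintegral_lintegral_kernel (hK : AEStronglyMeasurable K (leb.prod leb)) :
    ∫⁻ x, ∫⁻ y, ‖K (x, y)‖ₑ ^ (2 : ℝ) ∂leb ∂leb = eLpNorm K 2 (leb.prod leb) ^ (2 : ℝ) := by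
  rw [eLpNorm_two, ← ENNReal.rpow_mul, lintegral_prod _ (hK.enorm.pow_const _)]
  norm_num

/-- An integral operator is bounded by the norm of its kernel. -/
lemma eLpNorm_kernelOp_le (hK : AEStronglyMeasurable K (leb.prod leb)) (h : Hil) :
    eLpNorm (kernelOp K h) 2 leb ≤ eLpNorm K 2 (leb.prod leb) * eLpNorm h 2 leb := by
  have h1 : ∀ᵐ x ∂leb, ‖kernelOp K h x‖ₑ ^ (2 : ℝ)
      ≤ (∫⁻ y, ‖K (x, y)‖ₑ ^ (2 : ℝ) ∂leb) * eLpNorm h 2 leb ^ (2 : ℝ) := by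
    filter_upwards [hK.prodMk_left] with x hx
    have h2 := (enorm_integral_le_lintegral_enorm _).trans (lintegral_enorm_integrand_le h hx)
    refine (ENNReal.rpow_le_rpow h2 zero_le_two).trans (le_of_eq ?_)
    rw [ENNReal.mul_rpow_of_nonneg _ _ zero_le_two, ← ENNReal.rpow_mul]
    norm_num
  rw [eLpNorm_two (kernelOp K h)]
  refine (ENNReal.rpow_le_rpow (lintegral_mono_ae h1) one_half_pos.le).trans (le_of_eq ?_)
  have hN : eLpNorm h 2 leb ^ (2 : ℝ) ≠ ⊤ :=
    ENNReal.rpow_ne_top_of_nonneg (by norm_num) (Lp.eLpNorm_ne_top h)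
  rw [lintegral_mul_const' _ _ hN, lintegral_lintegral_kernel hK,
    ENNReal.mul_rpow_of_nonneg _ _ one_half_pos.le, ← ENNReal.rpow_mul, ← ENNReal.rpow_mul]
  norm_num

lemma ae_integrable_integrand (hK : MemLp K 2 (leb.prod leb)) (h : Hil) :
    ∀ᵐ x ∂leb, Integrable
      (fun y => act (K (x, y)) (h y)) leb := by
  have h1 : ∀ᵐ x ∂leb, ∫⁻ y, ‖K (x, y)‖ₑ ^ (2 : ℝ) ∂leb < ⊤ := by
    refine ae_lt_top' (hK.1.enorm.pow_const _).lintegral_prod_right' ?_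
    rw [lintegral_lintegral_kernel hK.1]
    exact ENNReal.rpow_ne_top_of_nonneg (by norm_num) hK.2.ne
  filter_upwards [h1, hK.1.prodMk_left, (aestronglyMeasurable_integrand hK.1 h).prodMk_left]
    with x hx hx' hm
  refine ⟨hm, lt_of_le_of_lt (lintegral_enorm_integrand_le h hx') ?_⟩
  exact ENNReal.mul_lt_top (ENNReal.rpow_lt_top_of_nonneg (by norm_num) hx.ne)
    (Lp.eLpNorm_lt_top h)

lemma kernelOp_sub (hK : MemLp K 2 (leb.prod leb)) (hK' : MemLp K' 2 (leb.prod leb)) (h : Hil) :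
    ∀ᵐ x ∂leb, kernelOp (K - K') h x = kernelOp K h x - kernelOp K' h x := by
  filter_upwards [ae_integrable_integrand hK h, ae_integrable_integrand hK' h] with x h1 h2
  unfold kernelOp
  rw [← integral_sub h1 h2]
  refine integral_congr_ae (Eventually.of_forall fun y => ?_)
  simp only [Pi.sub_apply, act_sub]

/-- The entries of the kernel of a projection. -/
def projEntries (f : Hil) (p : ℝ × ℝ) : Entries :=
  WithLp.toLp 2 fun ij => projKernel f p ij.1 ij.2

lemma toMat_projEntries (f : Hil) (p : ℝ × ℝ) : toMat (projEntries f p) = projKernel f p := rfl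

lemma norm_projEntries (f : Hil) (p : ℝ × ℝ) :
    ‖projEntries f p‖ = ‖(form f f)⁻¹‖ * (‖f p.1‖ * ‖f p.2‖) := by
  rw [← norm_toMat, toMat_projEntries, projKernel, norm_smul]
  congr 1
  rw [Matrix.frobenius_norm_def, EuclideanSpace.norm_eq, EuclideanSpace.norm_eq,
    ← Real.sqrt_mul (by positivity), Real.sqrt_eq_rpow]
  congr 1
  simp [Fin.sum_univ_two]
  ring

lemma aestronglyMeasurable_projEntries (f : Hil) :
    AEStronglyMeasurable (projEntries f) (leb.prod leb) := by
  have h1 : ∀ i, AEStronglyMeasurable (fun p : ℝ × ℝ => f p.1 i) (leb.prod leb) := fun i =>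
    (EuclideanSpace.proj (𝕜 := ℂ) i).continuous.comp_aestronglyMeasurable
      (Lp.aestronglyMeasurable f).comp_fst
  have h2 : ∀ i, AEStronglyMeasurable (fun p : ℝ × ℝ => conj (f p.2 i)) (leb.prod leb) := fun i =>
    Complex.continuous_conj.comp_aestronglyMeasurable
      ((EuclideanSpace.proj (𝕜 := ℂ) i).continuous.comp_aestronglyMeasurable
        (Lp.aestronglyMeasurable f).comp_snd)
  refine (PiLp.continuous_toLp 2 _).comp_aestronglyMeasurable
    (aemeasurable_pi_lambda _ fun ij => ?_).aestronglyMeasurable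
  obtain ⟨i, j⟩ := ij
  fin_cases i <;> fin_cases j
  · exact (((h1 0).mul (h2 1)).const_smul (form f f)⁻¹).aemeasurable
  · exact (((h1 0).mul (h2 0)).const_smul (form f f)⁻¹).aemeasurable
  · exact (((h1 1).mul (h2 1)).const_smul (form f f)⁻¹).aemeasurable
  · exact (((h1 1).mul (h2 0)).const_smul (form f f)⁻¹).aemeasurable

lemma norm_formProj (f : Hil) : ‖formProj swap f‖ = ‖(form f f)⁻¹‖ * (‖f‖ * ‖f‖) := by
  rw [formProj, norm_smul, InnerProductSpace.norm_rankOne, norm_involution swap_swap inner_swap_left,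
    form_eq_inner]

/-- The kernel is a tensor product, so Tonelli gives |⟨f, f⟩|⁻¹ ‖f‖². For rank one the
Hilbert-Schmidt norm and the operator norm agree; hence summability of the operator norms already
yields convergence of the kernels. -/
lemma eLpNorm_projEntries (f : Hil) :
    eLpNorm (projEntries f) 2 (leb.prod leb) = ENNReal.ofReal ‖formProj swap f‖ := by
  have h1 : ∀ p : ℝ × ℝ, ‖projEntries f p‖ₑ ^ (2 : ℝ)
      = ‖(form f f)⁻¹‖ₑ ^ (2 : ℝ) * (‖f p.1‖ₑ ^ (2 : ℝ) * ‖f p.2‖ₑ ^ (2 : ℝ)) := fun p => by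
    rw [← ENNReal.mul_rpow_of_nonneg _ _ zero_le_two, ← ENNReal.mul_rpow_of_nonneg _ _ zero_le_two,
      ← ofReal_norm, norm_projEntries, ENNReal.ofReal_mul (norm_nonneg _),
      ENNReal.ofReal_mul (norm_nonneg _), ofReal_norm, ofReal_norm, ofReal_norm]
  have hf := (Lp.aestronglyMeasurable f).enorm.pow_const (2 : ℝ)
  rw [eLpNorm_two]
  simp only [h1]
  rw [lintegral_const_mul' _ _ (ENNReal.rpow_ne_top_of_nonneg zero_le_two enorm_ne_top),
    lintegral_prod_mul hf hf, ENNReal.mul_rpow_of_nonneg _ _ one_half_pos.le,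
    ENNReal.mul_rpow_of_nonneg _ _ one_half_pos.le, ← eLpNorm_two, ← ENNReal.rpow_mul,
    norm_formProj, ENNReal.ofReal_mul (norm_nonneg _), ENNReal.ofReal_mul (norm_nonneg _),
    ofReal_norm, Lp.norm_def, ENNReal.ofReal_toReal (Lp.eLpNorm_ne_top f)]
  norm_num

lemma memLp_projEntries (f : Hil) : MemLp (projEntries f) 2 (leb.prod leb) :=
  ⟨aestronglyMeasurable_projEntries f, by rw [eLpNorm_projEntries]; exact ENNReal.ofReal_lt_top⟩

/-- The columns of the kernel carry the conjugated components of f in interchanged order, which is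
the effect of `J` in ⟪J f, h⟫. -/
lemma kernelOp_projEntries (f h : Hil) :
    ∀ᵐ x ∂leb, kernelOp (projEntries f) h x = formProj swap f h x := by
  have h1 := Lp.coeFn_smul ((form f f)⁻¹ * ⟪swap f, h⟫_ℂ) f
  filter_upwards [h1] with x hx
  have h2 : formProj swap f h = ((form f f)⁻¹ * ⟪swap f, h⟫_ℂ) • f := by
    rw [formProj_apply, form_eq_inner, smul_smul]
  rw [h2, hx, ← form_eq_inner, Pi.smul_apply, form.eq_1 h f, ← integral_const_mul,
    ← integral_smul_const, kernelOp]
  refine integral_congr_ae (Eventually.of_forall fun y => ?_)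
  simp only [act, toMat_projEntries]
  ext i
  fin_cases i <;> simp [projKernel, Matrix.mulVec, Matrix.smul_apply] <;> ring

/-- Unconditional norm convergence of kernels gives the kernel of the limit operator. -/
theorem exists_kernel_of_summable {ι : Type} (c : ι → ℂ) (f : ι → Hil)
    (hs : Summable fun i => ‖c i‖ * ‖formProj swap (f i)‖) :
    ∃ K : ℝ × ℝ → Mat, IsKernel K (∑' i, c i • formProj swap (f i)) ∧
      Tendsto (fun s : Finset ι =>
        eLpNorm (fun p => ∑ i ∈ s, c i • projKernel (f i) p - K p) 2 (leb.prod leb))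
        atTop (𝓝 0) := by
  let κ : ι → Lp Entries 2 (leb.prod leb) := fun i => c i • (memLp_projEntries (f i)).toLp _
  have hκ : Summable κ := by
    refine Summable.of_norm (hs.congr fun i => ?_)
    rw [norm_smul, Lp.norm_toLp, eLpNorm_projEntries, ENNReal.toReal_ofReal (norm_nonneg _)]
  obtain ⟨K, hK⟩ := hκ
  have hpart : ∀ s : Finset ι, (fun p => ∑ i ∈ s, c i • projEntries (f i) p - K p)
      =ᵐ[leb.prod leb] ⇑(∑ i ∈ s, κ i - K) := fun s => by
    have h1 : ∀ᵐ p ∂(leb.prod leb), ∀ i ∈ s, κ i p = c i • projEntries (f i) p := by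
      refine (Finset.eventually_all s).2 fun i _ => ?_
      filter_upwards [Lp.coeFn_smul (c i) ((memLp_projEntries (f i)).toLp _),
        (memLp_projEntries (f i)).coeFn_toLp] with p h2 h3
      rw [h2, Pi.smul_apply, h3]
    filter_upwards [Lp.coeFn_sub (∑ i ∈ s, κ i) K, Lp.coeFn_finsetSum s κ, h1] with p h2 h3 h4
    rw [h2, Pi.sub_apply, h3, Finset.sum_apply]
    rw [Finset.sum_congr rfl h4]
  have hlim : Tendsto (fun s : Finset ι =>
      eLpNorm (fun p => ∑ i ∈ s, c i • projEntries (f i) p - K p) 2 (leb.prod leb))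
      atTop (𝓝 0) := by
    have h1 := (Lp.tendsto_Lp_iff_tendsto_eLpNorm' _ _).1 hK
    refine h1.congr fun s => ?_
    rw [eLpNorm_congr_ae (hpart s)]
    exact eLpNorm_congr_ae (Lp.coeFn_sub _ _).symm
  have hKn : eLpNorm (fun p => toMat (K p)) 2 (leb.prod leb) = eLpNorm K 2 (leb.prod leb) :=
    eLpNorm_congr_norm_ae (Eventually.of_forall fun p => norm_toMat _)
  refine ⟨fun p => toMat (K p), ⟨⟨continuous_toMat.comp_aestronglyMeasurable (Lp.memLp K).1, ?_⟩,
    fun h => ?_⟩, hlim.congr fun s => eLpNorm_congr_norm_ae (Eventually.of_forall fun p => ?_)⟩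
  · rw [hKn]; exact (Lp.memLp K).2
  swap
  · rw [← norm_toMat, toMat_sub, toMat_sum]; rfl
  set R := ∑' i, c i • formProj swap (f i) with hR
  have hRs : HasSum (fun i => c i • formProj swap (f i)) R :=
    (Summable.of_norm (by simpa only [norm_smul] using hs)).hasSum
  have hRh : Tendsto (fun s : Finset ι => eLpNorm
      (⇑(∑ i ∈ s, c i • formProj swap (f i) h) - ⇑(R h)) 2 leb) atTop (𝓝 0) := by
    have h1 : HasSum (fun i => c i • formProj swap (f i) h) (R h) :=
      hRs.mapL (ContinuousLinearMap.apply ℂ Hil h)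
    exact (Lp.tendsto_Lp_iff_tendsto_eLpNorm' _ _).1 h1
  have hmem : ∀ s : Finset ι, MemLp (fun p => ∑ i ∈ s, c i • projEntries (f i) p) 2
      (leb.prod leb) := fun s => memLp_finsetSum s fun i _ => (memLp_projEntries (f i)).const_smul (c i)
  have hop : ∀ s : Finset ι, ∀ᵐ x ∂leb,
      kernelOp (fun p => ∑ i ∈ s, c i • projEntries (f i) p) h x
        = (∑ i ∈ s, c i • formProj swap (f i) h : Hil) x := fun s => by
    have h1 : ∀ᵐ x ∂leb, ∀ i ∈ s, (c i • formProj swap (f i) h : Hil) x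
        = c i • kernelOp (projEntries (f i)) h x := by
      refine (Finset.eventually_all s).2 fun i _ => ?_
      filter_upwards [Lp.coeFn_smul (c i) (formProj swap (f i) h), kernelOp_projEntries (f i) h]
        with x h2 h3
      rw [h2, Pi.smul_apply, h3]
    have h2 : ∀ᵐ x ∂leb, ∀ i ∈ s, Integrable
        (fun y => act (projEntries (f i) (x, y)) (h y)) leb :=
      (Finset.eventually_all s).2 fun i _ => ae_integrable_integrand (memLp_projEntries (f i)) h
    filter_upwards [h1, h2, Lp.coeFn_finsetSum s fun i => c i • formProj swap (f i) h]
      with x h3 h4 h5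
    rw [h5, Finset.sum_apply, Finset.sum_congr rfl h3]
    simp only [kernelOp, ← integral_smul]
    rw [← integral_finsetSum s (f := fun i y => c i • act (projEntries (f i) (x, y)) (h y))
      fun i hi => (h4 i hi).smul (c i)]
    refine integral_congr_ae (Eventually.of_forall fun y => ?_)
    simp only [act_sum, act_smul]
  have hm0 := aestronglyMeasurable_kernelOp (Lp.memLp K).1 h
  -- Partial sums converge to R as operators and to K as kernels, and the integral operator is
  -- controlled by the norm of its kernel. Both errors tend to zero while the left side does not
  -- depend on s.
  have hbound : ∀ s : Finset ι, eLpNorm (⇑(R h) - kernelOp K h) 2 leb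
      ≤ eLpNorm (⇑(∑ i ∈ s, c i • formProj swap (f i) h) - ⇑(R h)) 2 leb
        + eLpNorm (fun p => ∑ i ∈ s, c i • projEntries (f i) p - K p) 2 (leb.prod leb)
          * eLpNorm h 2 leb := fun s => by
    have h1 := eLpNorm_kernelOp_le ((hmem s).sub (Lp.memLp K)).1 h
    have h2 : kernelOp ((fun p => ∑ i ∈ s, c i • projEntries (f i) p) - K) h
        =ᵐ[leb] ⇑(∑ i ∈ s, c i • formProj swap (f i) h) - kernelOp K h := by
      filter_upwards [kernelOp_sub (hmem s) (Lp.memLp K) h, hop s] with x h3 h4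
      rw [h3, h4, Pi.sub_apply]
    rw [eLpNorm_congr_ae h2] at h1
    have hm1 := Lp.aestronglyMeasurable (R h)
    have hm2 := Lp.aestronglyMeasurable (∑ i ∈ s, c i • formProj swap (f i) h)
    rw [eLpNorm_sub_comm (⇑(∑ i ∈ s, c i • formProj swap (f i) h)) (⇑(R h))]
    refine le_trans ?_ (add_le_add_right h1 _)
    have h3 := eLpNorm_add_le (hm1.sub hm2) (hm2.sub hm0) (one_le_two (α := ℝ≥0∞))
    rwa [sub_add_sub_cancel] at h3
  have hzero : eLpNorm (⇑(R h) - kernelOp K h) 2 leb = 0 := by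
    have h1 := hRh.add (ENNReal.Tendsto.mul_const hlim (Or.inr (Lp.eLpNorm_ne_top h)))
    rw [zero_mul, add_zero] at h1
    exact le_antisymm (ge_of_tendsto' h1 hbound) bot_le
  rw [eLpNorm_eq_zero_iff ((Lp.aestronglyMeasurable (R h)).sub hm0) two_ne_zero] at hzero
  filter_upwards [hzero] with x hx
  exact sub_eq_zero.1 hx

end Kernel

end Beam

/-! ### The resolvent expansion for the Dirichlet problem. -/

theorem mainTheorem9 (m n : Measure ℝ) [IsFiniteMeasure m] [IsFiniteMeasure n]
    (hm : m (Icc (-1) 1)ᶜ = 0) (hn : n (Icc (-1) 1)ᶜ = 0)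
    (hm_left : m {-1} = 0) (hm_right : m {1} = 0)
    (hn_left : n {-1} = 0) (hn_right : n {1} = 0)
    (C : ℝ≥0) (hCm : m + n ≤ C • m) (hCn : m + n ≤ C • n)
    (f : Beam.eigenvalues m n → Beam.Hil)
    (hf : ∀ ν : Beam.eigenvalues m n, Beam.IsEigenfunction m n ν (f ν))
    (l : ℂ) (hl : l ∉ Beam.eigenvalues m n) :
    (∀ ν, Beam.form (f ν) (f ν) ≠ 0) ∧
    IsUnit (1 - l • Beam.T m n) ∧
    ∃ K : ℝ × ℝ → Matrix (Fin 2) (Fin 2) ℂ,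
      Beam.IsKernel K (Beam.R m n l) ∧
      Tendsto
        (fun s : Finset (Beam.eigenvalues m n) =>
          eLpNorm (fun p => ∑ ν ∈ s, (l / (l - ν)) • Beam.projKernel (f ν) p - K p) 2
            (Beam.leb.prod Beam.leb))
        atTop (𝓝 0) := by
  have hnm : n ≪ m := (Measure.absolutelyContinuous_of_le
    ((Measure.le_add_left le_rfl).trans hCm)).trans (Measure.AbsolutelyContinuous.rfl.smul_left C)
  have hmn : m ≪ n := (Measure.absolutelyContinuous_of_le
    ((Measure.le_add_right le_rfl).trans hCn)).trans (Measure.AbsolutelyContinuous.rfl.smul_left C)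
  obtain ⟨q, hq⟩ := Beam.isEigenSystem hm hn hmn hnm f hf
  -- The eigenvalues of `T` are the reciprocals of the Dirichlet eigenvalues, so l a = 1 would make
  -- l itself an eigenvalue.
  obtain ⟨hs, h1, h2⟩ := hq.resolvent (l := l) fun ν h => hl (by
    have h0 : (ν : ℂ) ≠ 0 := fun h0 => hq.ne ν (by simp [h0])
    have h3 : l = ν := by
      rw [mul_inv_eq_one₀ h0] at h; exact h
    rw [h3]; exact ν.2)
  simp only [inv_inv] at hs h1 h2
  have hR : Beam.R m n l = ∑' ν : Beam.eigenvalues m n, (l / (l - ν)) • Beam.formProj Beam.swap (f ν) := by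
    let u : (Beam.Hil →L[ℂ] Beam.Hil)ˣ := ⟨_, _, h1, h2⟩
    have h3 : Ring.inverse (1 - l • Beam.T m n)
        = 1 - ∑' ν : Beam.eigenvalues m n, (l / (l - ν)) • Beam.formProj Beam.swap (f ν) :=
      Ring.inverse_unit u
    rw [Beam.R, h3, sub_sub_cancel]
  refine ⟨fun ν => ?_, ⟨⟨_, _, h1, h2⟩, rfl⟩, ?_⟩
  · rw [Beam.form_eq_inner]
    exact Beam.eigen_form_ne_zero hq.invol hq.symmJ hq.symm hq.eq (hq.ne ν) (hq.vec_ne ν)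
      (hq.eigen ν)
  · rw [hR]
    exact Beam.exists_kernel_of_summable _ f hs
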